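/- Let $\mathfrak H$ be a real separable Hilbert space with complete orthonormal system $\{e_i\}$, and let $W=\{W(h):h\in\mathfrak H\}$ be an isonormal Gaussian process over $\mathfrak H$ (a centered Gaussian family with $E[W(h)W(g)]=\langle h,g\rangle_{\mathfrak H}$) on a probability space $(\Omega,\mathcal F,\mathbb P)$ with $\mathcal F=\sigma(W)$. Let $I_2$ be the double Wiener–Itô integral, i.e. the linear isometry from the symmetric Hilbert tensor square $\mathfrak H^{\odot 2}$, with norm $\sqrt 2\,\|\cdot\|_{\mathfrak H^{\otimes 2}}$, into $L^2(\Omega)$ such that $I_2(h\otimes h)=W(h)^2-1$ for $\|h\|=1$. For $f\in\mathfrak H^{\odot 2}$ let $A_f:\mathfrak H\to\mathfrak H$, $g\mapsto f\otimes_1 g$, be the associated Hilbert–Schmidt operator, $\{\alpha_{f,j}\}_{j\ge1}$ its eigenvalues (nonzero ones repeated according to multiplicity, the sequence being completed by zeros if necessary), and define $f\otimes_1^{(1)}f=f$, $f\otimes_1^{(p)}f=(f\otimes_1^{(p-1)}f)\otimes_1 f$ for $p\ge 2$, where $f\otimes_1 g=\sum_i\langle f,e_i\rangle\otimes\langle g,e_i\rangle$.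 Let $D$ be the Malliavin derivative and $L^{-1}=\sum_{q\ge1}-\frac1q J_q$, with $J_q$ the orthogonal projection of $L^2(\Omega)$ onto the $q$-th Wiener chaos; set $\Gamma_0(F)=F$, $\Gamma_i(F)=\langle DF,-DL^{-1}\Gamma_{i-1}(F)\rangle_{\mathfrak H}$ for $i\geq 1$. Let $\kappa_r(F)=(-\mathrm i)^r\frac{d^r}{dt^r}\log E[e^{\mathrm itF}]\big|_{t=0}$ be the $r$-th cumulant. Fix $f_\infty\in\mathfrak H^{\odot2}$ such that $A_{f_\infty}$ has only finitely many nonzero eigenvalues $\alpha_1,\dots,\alpha_k$, all distinct (each of multiplicity one), let $F_\infty=I_2(f_\infty)$, and set $P(x)=x\prod_{i=1}^k(x-\alpha_i)$, $Q=P^2$. Then for every $f\in\mathfrak H^{\odot 2}$, with $F=I_2(f)$, $$\sum_{r=2}^{\deg Q}\frac{Q^{(r)}(0)}{r!}\frac{\kappa_r(F)}{2^{r-1}(r-1)!}=\sum_{j\ge1}Q(\alpha_{f,j})=\Bigg\|\sum_{r=1}^{\deg P}\frac{P^{(r)}(0)}{r!}f\otimes_1^{(r)}f\Bigg\|^2_{\mathfrak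 H^{\otimes2}}=\frac12E\Bigg(\sum_{r=1}^{\deg P}\frac{P^{(r)}(0)}{r!\,2^{r-1}}\big(\Gamma_{r-1}(F)-E[\Gamma_{r-1}(F)]\big)\Bigg)^2 ,$$ the series converging. Moreover, for every $r\ge1$, $f\otimes_1^{(r)}f\in\mathfrak H^{\odot 2}$ and $I_2(f\otimes_1^{(r)}f)=2^{1-r}\big(\Gamma_{r-1}(F)-E[\Gamma_{r-1}(F)]\big)$ almost surely. In particular, for $f=f_\infty$ and $F=F_\infty$ all four quantities are equal to $0$ (the second one being $\sum_{i=1}^kQ(\alpha_i)$). -/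

import Mathlib

open MeasureTheory ProbabilityTheory
open scoped TensorProduct

noncomputable section

namespace WienerChaos

section Tensor

variable (H : Type*) [NormedAddCommGroup H] [InnerProductSpace ℝ H]

/-- The Hilbert space tensor square `H ⊗ H`: the completion of the algebraic tensor square for
the inner product with `⟪u ⊗ v, u' ⊗ v'⟫ = ⟪u, u'⟫ ⟪v, v'⟫`. -/
abbrev Tensor2 : Type _ := UniformSpace.Completion (H ⊗[ℝ] H)

variable {H}

/-- The elementary tensor `u ⊗ v` in the Hilbert space tensor square. -/
def tmul2 (u v : H) : Tensor2 H := ((u ⊗ₜ[ℝ] v : H ⊗[ℝ] H) : UniformSpace.Completion (H ⊗[ℝ] H))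

theorem norm_tmul2 (u v : H) : ‖tmul2 u v‖ = ‖u‖ * ‖v‖ := by
  simp [tmul2]

theorem tmul2_add_left (u u' v : H) : tmul2 (u + u') v = tmul2 u v + tmul2 u' v := by
  simp [tmul2, TensorProduct.add_tmul, UniformSpace.Completion.coe_add]

theorem tmul2_smul_left (c : ℝ) (u v : H) : tmul2 (c • u) v = c • tmul2 u v := by
  simp [tmul2, ← TensorProduct.smul_tmul', UniformSpace.Completion.coe_smul]

theorem tmul2_add_right (u v v' : H) : tmul2 u (v + v') = tmul2 u v + tmul2 u v' := by
  simp [tmul2, TensorProduct.tmul_add, UniformSpace.Completion.coe_add]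

theorem tmul2_smul_right (c : ℝ) (u v : H) : tmul2 u (c • v) = c • tmul2 u v := by
  simp [tmul2, UniformSpace.Completion.coe_smul]

variable (H) in
/-- The symmetric tensor square: the tensors that are invariant under exchanging the two
factors. -/
def symTensor2 : Submodule ℝ (Tensor2 H) where
  carrier := {f | ∀ u v : H, inner ℝ f (tmul2 u v) = inner ℝ f (tmul2 v u)}
  zero_mem' := by intro u v; simp
  add_mem' := by
    intro f g hf hg u v
    rw [inner_add_left, inner_add_left, hf u v, hg u v]
  smul_mem' := by
    intro c f hf u v
    rw [inner_smul_left, inner_smul_left, hf u v]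

theorem tmul2_self_mem (h : H) : tmul2 h h ∈ symTensor2 H := by
  intro u v
  simp only [tmul2, UniformSpace.Completion.inner_coe, TensorProduct.inner_tmul]
  ring

/-- The map `u ↦ u ⊗ v`. -/
def tmulRight (v : H) : H →L[ℝ] Tensor2 H :=
  LinearMap.mkContinuous
    { toFun := fun u => tmul2 u v
      map_add' := fun u u' => tmul2_add_left u u' v
      map_smul' := fun c u => tmul2_smul_left c u v }
    ‖v‖ (fun u => by
      change ‖tmul2 u v‖ ≤ _
      rw [norm_tmul2, mul_comm])

variable [CompleteSpace H]

/-- The operator `A_f : g ↦ f ⊗₁ g` attached to a kernel `f`, the contraction of the second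
variable of `f` against `g`: it is characterized by `⟪A_f g, w⟫ = ⟪f, w ⊗ g⟫`
(see `inner_hsOp`). -/
def hsOp (f : Tensor2 H) : H →L[ℝ] H :=
  LinearMap.mkContinuous
    { toFun := fun g => ContinuousLinearMap.adjoint (tmulRight g) f
      map_add' := fun g g' => by
        refine ext_inner_right ℝ fun w => ?_
        rw [inner_add_left]
        simp only [ContinuousLinearMap.adjoint_inner_left]
        rw [← inner_add_right]
        congr 1
        exact tmul2_add_right w g g'
      map_smul' := fun c g => by
        refine ext_inner_right ℝ fun w => ?_
        rw [RingHom.id_apply, real_inner_smul_left]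
        simp only [ContinuousLinearMap.adjoint_inner_left]
        rw [← real_inner_smul_right]
        congr 1
        exact tmul2_smul_right c w g }
    ‖f‖ (fun g => by
      change ‖ContinuousLinearMap.adjoint (tmulRight g) f‖ ≤ _
      refine (ContinuousLinearMap.le_opNorm _ _).trans ?_
      rw [LinearIsometryEquiv.norm_map, mul_comm]
      exact mul_le_mul_of_nonneg_left
        (LinearMap.mkContinuous_norm_le _ (norm_nonneg _) _) (norm_nonneg _))

theorem inner_hsOp (f : Tensor2 H) (g w : H) :
    inner ℝ (hsOp f g) w = inner ℝ f (tmul2 w g) :=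
  ContinuousLinearMap.adjoint_inner_left (tmulRight g) w f

/-- The contraction `f ⊗₁ g = ∑ᵢ ⟨f, eᵢ⟩ ⊗ ⟨g, eᵢ⟩` of order one of two kernels, along the complete
orthonormal system `e`. -/
def contr {ι : Type*} (e : HilbertBasis ι ℝ H) (f g : Tensor2 H) : Tensor2 H :=
  ∑' i, tmul2 (hsOp f (e i)) (hsOp g (e i))

/-- The iterated contractions `f ⊗₁⁽ᵖ⁾ f`, for `p ≥ 1`: the first one is `f`, and
`f ⊗₁⁽ᵖ⁾ f = (f ⊗₁⁽ᵖ⁻¹⁾ f) ⊗₁ f` for `p ≥ 2`. (The value at `p = 0` is not used.) -/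
def iterContr {ι : Type*} (e : HilbertBasis ι ℝ H) (f : Tensor2 H) : ℕ → Tensor2 H
  | 0 => 0
  | 1 => f
  | (p + 2) => contr e (iterContr e f (p + 1)) f

/-- `α` lists the eigenvalues of `A_f`, each nonzero one as often as its multiplicity; the list
may also contain zeros. -/
def ListsEigenvalues (f : Tensor2 H) {J : Type*} (α : J → ℝ) : Prop :=
  ∀ c : ℝ, c ≠ 0 → {j | α j = c}.encard =
    Cardinal.toENat (Module.rank ℝ (Module.End.eigenspace (hsOp f : H →ₗ[ℝ] H) c))

end Tensor

section Isonormal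

variable {H : Type*} [NormedAddCommGroup H] [InnerProductSpace ℝ H]
  {Ω : Type*} [mΩ : MeasurableSpace Ω]

/-- `W` is an isonormal Gaussian process over `H`, and it generates the sigma-algebra of the
probability space. -/
structure IsIsonormal (W : H → Ω → ℝ) (P : Measure Ω) : Prop where
  gaussian : IsGaussianProcess W P
  centered : ∀ h, ∫ ω, W h ω ∂P = 0
  covariance : ∀ h g, ∫ ω, W h ω * W g ω ∂P = inner ℝ h g
  generates : mΩ = ⨆ h, MeasurableSpace.comap (W h) inferInstance

/-- The random variable `H_q(W(h))`, with `H_q` the `q`-th (probabilists') Hermite polynomial. -/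
def hermiteRV (W : H → Ω → ℝ) (q : ℕ) (h : H) : Ω → ℝ :=
  fun ω => Polynomial.aeval (W h ω) (Polynomial.hermite q)

/-- The `q`-th Wiener chaos, for `q ≥ 1`: the closed linear span in `L²` of the `H_q(W(h))` with
`‖h‖ = 1`. -/
def chaos (W : H → Ω → ℝ) (P : Measure Ω) (q : ℕ) : Submodule ℝ (Lp ℝ 2 P) :=
  (Submodule.span ℝ {X : Lp ℝ 2 P | ∃ h : H, ‖h‖ = 1 ∧ X =ᵐ[P] hermiteRV W q h}).topologicalClosure

instance (W : H → Ω → ℝ) (P : Measure Ω) (q : ℕ) : CompleteSpace (chaos W P q) :=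
  Submodule.topologicalClosure.completeSpace _

/-- The orthogonal projection `J_q` of `L²` onto the `q`-th chaos. -/
def chaosProj (W : H → Ω → ℝ) (P : Measure Ω) (q : ℕ) : Lp ℝ 2 P →L[ℝ] Lp ℝ 2 P :=
  (chaos W P q).starProjection

/-- The pseudo-inverse `L⁻¹ X = ∑_{q ≥ 1} -(1/q) J_q X` of the Ornstein-Uhlenbeck generator, as a
series in `L²`. -/
def pseudoInv (W : H → Ω → ℝ) (P : Measure Ω) (X : Lp ℝ 2 P) : Lp ℝ 2 P :=
  ∑' q : ℕ, (-(1 / ((q : ℝ) + 1))) • chaosProj W P (q + 1) X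

/-- `I` is a linear map on the symmetric tensor square with `I(h ⊗ h) = H_2(W(h))` for all
unit vectors `h`, and it is isometric for the modified norm `√(2!) ‖·‖`. -/
def IsDoubleIntegral (W : H → Ω → ℝ) (P : Measure Ω) (I : symTensor2 H →L[ℝ] Lp ℝ 2 P) : Prop :=
  (∀ f, ‖I f‖ = √2 * ‖f‖) ∧
    ∀ h : H, ‖h‖ = 1 → I ⟨tmul2 h h, tmul2_self_mem h⟩ =ᵐ[P] hermiteRV W 2 h

open Classical in
/-- The double Wiener-Itô integral `I_2`: the (unique) extension of `h ⊗ h ↦ H_2(W(h))`, `‖h‖ = 1`,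
to a linear isometry from the symmetric tensor square with the modified norm into `L²`.
(Such an extension exists for every isonormal Gaussian process.) -/
def doubleIntegral (W : H → Ω → ℝ) (P : Measure Ω) : symTensor2 H →L[ℝ] Lp ℝ 2 P :=
  if hI : ∃ I, IsDoubleIntegral W P I then hI.choose else 0

/-- The pairs `(F, DF)` with `F = g(W(φ₁), …, W(φₙ))` a smooth cylindrical random variable
(`g` smooth, all derivatives of polynomial growth) and
`DF = ∑ᵢ ∂ᵢg(W(φ₁), …, W(φₙ)) φᵢ` its Malliavin derivative. -/
def cylindricalGraph (W : H → Ω → ℝ) (P : Measure Ω) : Set (Lp ℝ 2 P × Lp H 2 P) :=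
  {p | ∃ (n : ℕ) (g : (Fin n → ℝ) → ℝ) (φ : Fin n → H), Function.HasTemperateGrowth g ∧
    p.1 =ᵐ[P] (fun ω => g (fun i => W (φ i) ω)) ∧
    p.2 =ᵐ[P] (fun ω => ∑ i, fderiv ℝ g (fun j => W (φ j) ω) (Pi.single i 1) • φ i)}

/-- The Malliavin derivative as a closed unbounded operator from `L²(Ω)` to `L²(Ω; H)`: the closure
of the derivative on smooth cylindrical random variables. Its domain is `𝔻^{1,2}`, the closure of
the cylindrical random variables for the norm `(E[F²] + E[‖DF‖²])^{1/2}`. -/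
def malliavinOp (W : H → Ω → ℝ) (P : Measure Ω) : Lp ℝ 2 P →ₗ.[ℝ] Lp H 2 P :=
  (Submodule.span ℝ (cylindricalGraph W P)).topologicalClosure.toLinearPMap

open Classical in
/-- The Malliavin derivative `DX` of `X ∈ 𝔻^{1,2}` (and zero for other `X`). -/
def malliavinD (W : H → Ω → ℝ) (P : Measure Ω) (X : Lp ℝ 2 P) : Lp H 2 P :=
  if hX : X ∈ (malliavinOp W P).domain then malliavinOp W P ⟨X, hX⟩ else 0

open Classical in
/-- The class in `L²` of a square-integrable random variable (and zero for other ones). -/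
def toL2 (P : Measure Ω) (X : Ω → ℝ) : Lp ℝ 2 P :=
  if hX : MemLp X 2 P then hX.toLp X else 0

/-- The operators `Γ_i`: `Γ_0(F) = F` and `Γ_{i+1}(F) = ⟪DF, -D L⁻¹ Γ_i(F)⟫`. -/
def gammaOp (W : H → Ω → ℝ) (P : Measure Ω) (F : Lp ℝ 2 P) : ℕ → Lp ℝ 2 P
  | 0 => F
  | (i + 1) => toL2 P (fun ω =>
      inner ℝ (malliavinD W P F ω) (-(malliavinD W P (pseudoInv W P (gammaOp W P F i)) ω)))

end Isonormal

/-- The `j`-th cumulant `κ_j(X) = (-i)^j (d/dt)^j log E[exp(itX)]` at `t = 0` of a real random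
variable (the right-hand side is a real number if `X` has a finite moment of order `j`). -/
def cumulant {Ω : Type*} [MeasurableSpace Ω] (P : Measure Ω) (X : Ω → ℝ) (j : ℕ) : ℝ :=
  ((-Complex.I) ^ j *
    iteratedDeriv j (fun t : ℝ => Complex.log (charFun (P.map X) t)) 0).re

/-- The polynomial `P(x) = x ∏ᵢ (x - αᵢ)`. -/
def polyP {k : ℕ} (α : Fin k → ℝ) : Polynomial ℝ :=
  Polynomial.X * ∏ i, (Polynomial.X - Polynomial.C (α i))

/-- The polynomial `Q = P²`. -/
def polyQ {k : ℕ} (α : Fin k → ℝ) : Polynomial ℝ := polyP α ^ 2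

/-- The Taylor coefficient `p⁽ʳ⁾(0) / r!`. -/
def taylorCoeff (p : Polynomial ℝ) (r : ℕ) : ℝ :=
  (Polynomial.derivative^[r] p).eval 0 / (r.factorial : ℝ)

/-- `∑_{r=2}^{deg Q} (Q⁽ʳ⁾(0) / r!) κ_r(X) / (2^{r-1} (r-1)!)`. -/
def cumulantSum {Ω : Type*} [MeasurableSpace Ω] (P : Measure Ω) (Q : Polynomial ℝ)
    (X : Ω → ℝ) : ℝ :=
  ∑ r ∈ Finset.Icc 2 Q.natDegree,
    taylorCoeff Q r * (cumulant P X r / (2 ^ (r - 1) * ((r - 1).factorial : ℝ)))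

/-- `∑_{r=1}^{deg p} (p⁽ʳ⁾(0) / r!) f ⊗₁⁽ʳ⁾ f`. -/
def contrSum {H : Type*} [NormedAddCommGroup H] [InnerProductSpace ℝ H] [CompleteSpace H]
    {ι : Type*} (e : HilbertBasis ι ℝ H) (p : Polynomial ℝ) (f : Tensor2 H) : Tensor2 H :=
  ∑ r ∈ Finset.Icc 1 p.natDegree, taylorCoeff p r • iterContr e f r

/-- `∑_{r=1}^{deg p} (p⁽ʳ⁾(0) / (r! 2^{r-1})) (Γ_{r-1}(F) - E[Γ_{r-1}(F)])`. -/
def gammaSum {H : Type*} [NormedAddCommGroup H] [InnerProductSpace ℝ H]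
    {Ω : Type*} [MeasurableSpace Ω] (W : H → Ω → ℝ) (P : Measure Ω) (p : Polynomial ℝ)
    (F : Lp ℝ 2 P) : Ω → ℝ := fun ω =>
  ∑ r ∈ Finset.Icc 1 p.natDegree, (taylorCoeff p r / 2 ^ (r - 1)) *
    (gammaOp W P F (r - 1) ω - ∫ ω', gammaOp W P F (r - 1) ω' ∂P)

end WienerChaos

end

open WienerChaos

/-! The operator `A = hsOp f` of a symmetric kernel is self-adjoint and compact, so it is diagonal
in a Hilbert basis `b` with eigenvalues `lam` (`exists_eigenbasis`), and `lam` is square summable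
with sum `‖f‖ ^ 2`. All the quantities in the statement are equal to `∑ Q (lam j)`, for three
reasons.

Contractions. The operator of `contr e f g` is `A_f A_g*` (`hsOp_contr`), so the iterated
contractions of `f` correspond to the powers of `A`, and `contrSum` to `P(A)`. Its norm is the
Hilbert-Schmidt norm, whose square is `∑ P (lam j) ^ 2` (`hasSum_norm_sq_contrSum`).

Cumulants. The double integral of `f` is `∑ lam j (W(b j)² - 1)` with independent standard Gaussians
`W(b j)`. The logarithm of its characteristic function near `0` is thus a double series in `j` and
in the powers of `t`. Summing over `j` first shows that `κ_r = 2^(r-1) (r-1)! ∑ lam j ^ r` for `r ≥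
2` (`cumulant_wickL`). As `Q` vanishes to second order at `0`, these power sums add up to `∑ Q (lam
j)`.

Gamma operators. Write `I₁(f)` for the `H`-valued first integral `vectorL`. Then `D I₂(f) = 2
I₁(f)`, `L⁻¹` is `-1/2` on the second chaos and kills constants, and `⟨I₁(g), I₁(f)⟩ = I₂(g ⊗₁ f) +
⟨g, f⟩`. By induction, `Γ_i(F)` is `2^i I₂(f ⊗₁⁽ⁱ⁺¹⁾ f)` plus a constant (`gammaOp_wickL`), and the
isometry of `I₂` turns the second moment into the norm of `contrSum`.

The abstract definitions have to be made computable first. `I₂` is identified with the map `wickL :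
u ⊗ v ↦ W(u) W(v) - ⟨u, v⟩`. The closure of `D` is the graph of an operator by Gaussian integration
by parts and the totality of the variables `cos W(u)`, `sin W(u)`. A sum over eigenvalues does not
depend on their listing because `Q 0 = 0` (`hasSum_of_listsEigenvalues`). For the target kernel
every listed eigenvalue is a root of `Q`, so everything vanishes. -/

namespace WienerChaos

/-! ### The Hilbert tensor square and its symmetric part -/

section TensorSquare

variable {H : Type*} [NormedAddCommGroup H] [InnerProductSpace ℝ H]
  {E : Type*} [NormedAddCommGroup E] [NormedSpace ℝ E]

theorem inner_tmul2 (u v u' v' : H) :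
    inner ℝ (tmul2 u v) (tmul2 u' v') = inner ℝ u u' * inner ℝ v v' := by
  simp [tmul2]

/-- A closed additive property of elementary tensors holds for all tensors. -/
theorem tensor2_induction {p : Tensor2 H → Prop} (hcl : IsClosed {t | p t})
    (htmul : ∀ u v, p (tmul2 u v)) (hadd : ∀ s t, p s → p t → p (s + t)) (t : Tensor2 H) : p t := by
  induction t using UniformSpace.Completion.induction_on with
  | hp => exact hcl
  | ih a =>
    induction a using TensorProduct.induction_on with
    | zero =>
      have := htmul 0 0
      simpa [tmul2] using this
    | tmul u v => exact htmul u v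
    | add s t hs ht =>
      rw [UniformSpace.Completion.coe_add]
      exact hadd _ _ hs ht

theorem tensor2_clm_ext {S T : Tensor2 H →L[ℝ] E}
    (h : ∀ u v, S (tmul2 u v) = T (tmul2 u v)) : S = T := by
  ext t
  refine tensor2_induction (p := fun t => S t = T t)
    (isClosed_eq S.continuous T.continuous) h (fun s t hs ht => ?_) t
  rw [map_add, map_add, hs, ht]

theorem eq_zero_of_inner_tmul2 {f : Tensor2 H} (h : ∀ u v, inner ℝ f (tmul2 u v) = 0) : f = 0 := by
  have : innerSL ℝ f = 0 := tensor2_clm_ext (fun u v => by simpa using h u v)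
  have h2 := congrArg (fun T => T f) this
  simpa using h2

theorem ext_inner_tmul2 {f g : Tensor2 H}
    (h : ∀ u v, inner ℝ f (tmul2 u v) = inner ℝ g (tmul2 u v)) : f = g := by
  rw [← sub_eq_zero]
  refine eq_zero_of_inner_tmul2 fun u v => ?_
  rw [inner_sub_left, h, sub_self]

/-- The extension to the Hilbert tensor square of a bilinear map that is bounded on the algebraic
tensor square. -/
noncomputable def tensor2Lift [CompleteSpace E] (B : H →ₗ[ℝ] H →ₗ[ℝ] E) : Tensor2 H →L[ℝ] E :=
  (TensorProduct.lift B).extendOfNorm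
    ((UniformSpace.Completion.toComplL : (H ⊗[ℝ] H) →L[ℝ] Tensor2 H) : (H ⊗[ℝ] H) →ₗ[ℝ] Tensor2 H)

/-- The extension agrees with `B` only when a bound exists, so the bound is asked for here and not
in the definition. -/
theorem tensor2Lift_tmul2 [CompleteSpace E] (B : H →ₗ[ℝ] H →ₗ[ℝ] E) (C : ℝ)
    (hC : ∀ t, ‖TensorProduct.lift B t‖ ≤ C * ‖t‖) (u v : H) :
    tensor2Lift B (tmul2 u v) = B u v := by
  have h := LinearMap.extendOfNorm_eq (f := TensorProduct.lift B)
    (e := ((UniformSpace.Completion.toComplL : (H ⊗[ℝ] H) →L[ℝ] Tensor2 H) :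
      (H ⊗[ℝ] H) →ₗ[ℝ] Tensor2 H)) (UniformSpace.Completion.denseRange_coe)
      ⟨C, fun t => by simpa using hC t⟩ (u ⊗ₜ v)
  rw [TensorProduct.lift.tmul] at h
  exact h

/-- The exchange of the two factors. -/
noncomputable def swap2 : Tensor2 H →L[ℝ] Tensor2 H :=
  tensor2Lift (E := Tensor2 H)
    (LinearMap.mk₂ ℝ (fun u v : H => tmul2 v u) (fun u u' v => tmul2_add_right v u u')
      (fun c u v => tmul2_smul_right c v u) (fun u v v' => tmul2_add_left v v' u)
      (fun c u v => tmul2_smul_left c v u))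

@[simp]
theorem swap2_tmul2 (u v : H) : swap2 (tmul2 u v) = tmul2 v u := by
  unfold swap2
  rw [tensor2Lift_tmul2 _ 1]
  · rfl
  -- On the algebraic tensor square the exchange is `TensorProduct.comm`, an isometry; hence the
  -- constant `1`.
  intro t
  have : TensorProduct.lift (LinearMap.mk₂ ℝ (fun u v : H => tmul2 v u)
      (fun u u' v => tmul2_add_right v u u')
      (fun c u v => tmul2_smul_right c v u) (fun u v v' => tmul2_add_left v v' u)
      (fun c u v => tmul2_smul_left c v u)) t =
      ((TensorProduct.comm ℝ H H t : H ⊗[ℝ] H) : Tensor2 H) := by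
    induction t using TensorProduct.induction_on with
    | zero => rw [map_zero, map_zero, UniformSpace.Completion.coe_zero]
    | tmul u v => rfl
    | add s t hs ht => rw [map_add, map_add, hs, ht, UniformSpace.Completion.coe_add]
  rw [this, UniformSpace.Completion.norm_coe, TensorProduct.norm_comm, one_mul]

theorem inner_swap2 {f : Tensor2 H} (hf : f ∈ symTensor2 H) (t : Tensor2 H) :
    inner ℝ f (swap2 t) = inner ℝ f t := by
  have : (innerSL ℝ f).comp swap2 = innerSL ℝ f :=
    tensor2_clm_ext (fun u v => by simpa using hf v u)
  simpa using congrArg (fun T => T t) this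

theorem inner_swap2_left (s t : Tensor2 H) : inner ℝ (swap2 s) t = inner ℝ s (swap2 t) := by
  refine tensor2_induction (p := fun s => inner ℝ (swap2 s) t = inner ℝ s (swap2 t))
    (isClosed_eq (by fun_prop) (by fun_prop)) (fun u v => ?_) (fun s s' hs hs' => ?_) s
  · refine tensor2_induction
      (p := fun t => inner ℝ (swap2 (tmul2 u v)) t = inner ℝ (tmul2 u v) (swap2 t))
      (isClosed_eq (by fun_prop) (by fun_prop)) (fun u' v' => ?_) (fun s s' hs hs' => ?_) t
    · rw [swap2_tmul2, swap2_tmul2, inner_tmul2, inner_tmul2, mul_comm]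
    · rw [map_add, inner_add_right, inner_add_right, hs, hs']
  · rw [map_add, inner_add_left, inner_add_left, hs, hs']

theorem swap2_eq_self {f : Tensor2 H} (hf : f ∈ symTensor2 H) : swap2 f = f :=
  ext_inner_tmul2 fun u v => by rw [inner_swap2_left, inner_swap2 hf]

/-- The resulting completeness is what permits the orthogonal complement argument in
`symTensor2_clm_ext`. -/
theorem isClosed_symTensor2 : IsClosed (symTensor2 H : Set (Tensor2 H)) := by
  have : (symTensor2 H : Set (Tensor2 H)) =
      ⋂ u : H, ⋂ v : H, {f | inner ℝ f (tmul2 u v) = inner ℝ f (tmul2 v u)} := by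
    ext f
    simp [symTensor2]
  rw [this]
  exact isClosed_iInter fun u => isClosed_iInter fun v => isClosed_eq (by fun_prop) (by fun_prop)

instance : CompleteSpace (symTensor2 H) := isClosed_symTensor2.completeSpace_coe

theorem tmul2_polarization (u v : H) :
    tmul2 u v + tmul2 v u = (1 / 2 : ℝ) • (tmul2 (u + v) (u + v) - tmul2 (u - v) (u - v)) := by
  have h : tmul2 (u - v) (u - v) = tmul2 u u - tmul2 u v - tmul2 v u + tmul2 v v := by
    have e : u - v = u + (-1 : ℝ) • v := by simp [sub_eq_add_neg]
    rw [e]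
    simp only [tmul2_add_left, tmul2_add_right, tmul2_smul_left, tmul2_smul_right]
    module
  rw [h]
  simp only [tmul2_add_left, tmul2_add_right]
  module

theorem tmul2_smul_smul (c : ℝ) (u : H) : tmul2 (c • u) (c • u) = c ^ 2 • tmul2 u u := by
  rw [tmul2_smul_left, tmul2_smul_right, smul_smul, sq]

/-- A bounded linear map on the symmetric tensor square is determined by its values on the squares
of unit vectors. -/
theorem symTensor2_clm_ext {S T : symTensor2 H →L[ℝ] E}
    (h : ∀ u : H, ‖u‖ = 1 → S ⟨tmul2 u u, tmul2_self_mem u⟩ = T ⟨tmul2 u u, tmul2_self_mem u⟩) :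
    S = T := by
  have hall : ∀ u : H, S ⟨tmul2 u u, tmul2_self_mem u⟩ = T ⟨tmul2 u u, tmul2_self_mem u⟩ := by
    intro u
    by_cases hu : u = 0
    · have : (⟨tmul2 u u, tmul2_self_mem u⟩ : symTensor2 H) = 0 := by
        subst hu; ext; simp [tmul2]
      rw [this, map_zero, map_zero]
    · have hn : ‖u‖ ≠ 0 := norm_ne_zero_iff.mpr hu
      have e : (⟨tmul2 u u, tmul2_self_mem u⟩ : symTensor2 H) =
          ‖u‖ ^ 2 • ⟨tmul2 (‖u‖⁻¹ • u) (‖u‖⁻¹ • u), tmul2_self_mem _⟩ := by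
        ext
        change tmul2 u u = ‖u‖ ^ 2 • tmul2 (‖u‖⁻¹ • u) (‖u‖⁻¹ • u)
        rw [tmul2_smul_smul, smul_smul]
        simp [hn]
      rw [e, map_smul, map_smul, h _ (by rw [norm_smul, norm_inv, norm_norm, inv_mul_cancel₀ hn])]
  -- The kernel of `S - T` is closed and contains all squares. A symmetric `f` orthogonal to the
  -- squares is orthogonal to `u ⊗ v + v ⊗ u` by polarization, hence to `u ⊗ v` by symmetry, so `f =
  -- 0` and the kernel is everything.
  let K : Submodule ℝ (symTensor2 H) := LinearMap.ker ((S - T : symTensor2 H →L[ℝ] E) : symTensor2 H →ₗ[ℝ] E)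
  have hKc : IsClosed (K : Set (symTensor2 H)) := (S - T).isClosed_ker
  have hmem : ∀ u : H, (⟨tmul2 u u, tmul2_self_mem u⟩ : symTensor2 H) ∈ K := fun u => by
    simp only [K, LinearMap.mem_ker]
    simpa using sub_eq_zero.mpr (hall u)
  have hperp : Submodule.orthogonal (𝕜 := ℝ) (E := symTensor2 H) K = ⊥ := by
    rw [Submodule.eq_bot_iff]
    intro f hf
    rw [Submodule.mem_orthogonal'] at hf
    have h0 : ∀ u, inner ℝ (f : Tensor2 H) (tmul2 u u) = 0 := fun u => hf _ (hmem u)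
    ext1
    refine eq_zero_of_inner_tmul2 fun u v => ?_
    have h1 : inner ℝ (f : Tensor2 H) (tmul2 u v + tmul2 v u) = 0 := by
      rw [tmul2_polarization, inner_smul_right, inner_sub_right, h0, h0]; simp
    rw [inner_add_right, ← f.2 u v] at h1
    linarith
  have hK : K = ⊤ := by
    have : K.topologicalClosure = ⊤ :=
      (Submodule.topologicalClosure_eq_top_iff (𝕜 := ℝ) (E := symTensor2 H)).mpr hperp
    rwa [hKc.submodule_topologicalClosure_eq] at this
  ext f
  have : f ∈ K := hK ▸ Submodule.mem_top
  simp only [K, LinearMap.mem_ker] at this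
  exact sub_eq_zero.mp (by simpa using this)

end TensorSquare

/-! ### The Hilbert-Schmidt operator of a kernel -/

section Operators

variable {H : Type*} [NormedAddCommGroup H] [InnerProductSpace ℝ H] [CompleteSpace H]

theorem hsOp_add (f g : Tensor2 H) : hsOp (f + g) = hsOp f + hsOp g := by
  ext x
  refine ext_inner_right ℝ fun w => ?_
  simp [inner_hsOp, inner_add_left]

theorem hsOp_smul (c : ℝ) (f : Tensor2 H) : hsOp (c • f) = c • hsOp f := by
  ext x
  refine ext_inner_right ℝ fun w => ?_
  simp [inner_hsOp, inner_smul_left]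

theorem hsOp_zero : hsOp (0 : Tensor2 H) = 0 := by
  simpa using hsOp_smul 0 (0 : Tensor2 H)

theorem norm_hsOp_le (f : Tensor2 H) : ‖hsOp f‖ ≤ ‖f‖ :=
  LinearMap.mkContinuous_norm_le _ (norm_nonneg _) _

variable (H) in
/-- The map `f ↦ A_f` as a bounded linear map. -/
noncomputable def hsOpL : Tensor2 H →L[ℝ] (H →L[ℝ] H) :=
  LinearMap.mkContinuous ⟨⟨hsOp, hsOp_add⟩, hsOp_smul⟩ 1
    (fun f => by simpa using norm_hsOp_le f)

@[simp]
theorem hsOpL_apply (f : Tensor2 H) : hsOpL H f = hsOp f := rfl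

/-- Identities between tensors can therefore be checked on operators, where contraction becomes
composition. -/
theorem hsOp_injective : Function.Injective (hsOp : Tensor2 H → H →L[ℝ] H) := by
  intro f g h
  refine ext_inner_tmul2 fun u v => ?_
  rw [← inner_hsOp, ← inner_hsOp, h]

theorem hsOp_tmul2 (a b g : H) : hsOp (tmul2 a b) g = (inner ℝ b g : ℝ) • a := by
  refine ext_inner_right ℝ fun w => ?_
  rw [inner_hsOp, inner_tmul2, inner_smul_left]
  simp [mul_comm]

theorem mem_symTensor2_iff {f : Tensor2 H} :
    f ∈ symTensor2 H ↔ ContinuousLinearMap.adjoint (hsOp f) = hsOp f := by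
  rw [← ContinuousLinearMap.isSelfAdjoint_iff', ContinuousLinearMap.isSelfAdjoint_iff_isSymmetric]
  constructor
  · intro h u v
    change inner ℝ (hsOp f u) v = inner ℝ u (hsOp f v)
    rw [real_inner_comm (hsOp f v) u, inner_hsOp, inner_hsOp]
    exact h v u
  · intro h u v
    rw [← inner_hsOp, ← inner_hsOp, real_inner_comm]
    exact (h u v).symm

variable {ι : Type*}

/-- The elementary tensors of the elements of a Hilbert basis form a Hilbert basis. -/
noncomputable def tensorBasis (e : HilbertBasis ι ℝ H) : HilbertBasis (ι × ι) ℝ (Tensor2 H) :=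
  HilbertBasis.mkOfOrthogonalEqBot (v := fun p : ι × ι => tmul2 (e p.1) (e p.2))
    (by
      classical
      rw [orthonormal_iff_ite]
      intro p q
      rw [inner_tmul2, orthonormal_iff_ite.mp e.orthonormal, orthonormal_iff_ite.mp e.orthonormal]
      by_cases h1 : p.1 = q.1 <;> by_cases h2 : p.2 = q.2 <;> simp [h1, h2, Prod.ext_iff])
    (by
      rw [Submodule.eq_bot_iff]
      intro f hf
      rw [Submodule.mem_orthogonal'] at hf
      have h0 : ∀ i j, inner ℝ f (tmul2 (e i) (e j)) = 0 := fun i j =>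
        hf _ (Submodule.subset_span ⟨(i, j), rfl⟩)
      -- A tensor orthogonal to all `e i ⊗ e j` has an operator that vanishes on the basis, so it is
      -- zero.
      have h1 : ∀ j, hsOp f (e j) = 0 := fun j => by
        have := e.hasSum_repr (hsOp f (e j))
        have hz : ∀ i, e.repr (hsOp f (e j)) i = 0 := fun i => by
          rw [e.repr_apply_apply, real_inner_comm, inner_hsOp, h0]
        simp only [hz, zero_smul] at this
        exact this.unique hasSum_zero
      have h2 : hsOp f = 0 := by
        ext x
        have := (e.hasSum_repr x).mapL (hsOp f)
        simp only [map_smul, h1, smul_zero] at this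
        exact this.unique hasSum_zero
      exact hsOp_injective (h2.trans hsOp_zero.symm))

theorem tensorBasis_apply (e : HilbertBasis ι ℝ H) (p : ι × ι) :
    tensorBasis e p = tmul2 (e p.1) (e p.2) := by
  simp [tensorBasis]

/-- Parseval's identity in `tensorBasis e`, with the double sum grouped by one index: the inner
product of tensors is the Hilbert-Schmidt inner product of operators, in any basis. -/
theorem hasSum_inner_hsOp (e : HilbertBasis ι ℝ H) (f g : Tensor2 H) :
    HasSum (fun i => inner ℝ (hsOp f (e i)) (hsOp g (e i))) (inner ℝ f g) := by
  have h := (tensorBasis e).hasSum_inner_mul_inner f g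
  simp only [tensorBasis_apply] at h
  -- `hsOp` acts on the second factor, so the outer summation must run over the second index.
  rw [← (Equiv.prodComm ι ι).hasSum_iff] at h
  refine h.prod_fiberwise fun i => ?_
  have h2 := e.hasSum_inner_mul_inner (hsOp f (e i)) (hsOp g (e i))
  convert h2 using 2 with j
  simp only [Function.comp, Equiv.prodComm_apply, Prod.swap]
  rw [inner_hsOp, real_inner_comm g, ← inner_hsOp g, real_inner_comm (e j)]

end Operators

end WienerChaos

namespace WienerChaos

/-! ### Contractions as products of operators -/

section Contractions

variable {H : Type*} [NormedAddCommGroup H] [InnerProductSpace ℝ H] [CompleteSpace H]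
  {ι : Type*} (e : HilbertBasis ι ℝ H)

theorem hasSum_norm_sq_hsOp (f : Tensor2 H) :
    HasSum (fun i => ‖hsOp f (e i)‖ ^ 2) (‖f‖ ^ 2) := by
  simpa only [real_inner_self_eq_norm_sq] using hasSum_inner_hsOp e f f

/-- Cauchy-Schwarz for the two Hilbert-Schmidt norms. The absolute convergence ensures that the
`tsum` defining `contr` is the actual sum. -/
theorem norm_contr_aux (f g : Tensor2 H) :
    Summable (fun i => ‖tmul2 (hsOp f (e i)) (hsOp g (e i))‖) ∧
      ∑' i, ‖tmul2 (hsOp f (e i)) (hsOp g (e i))‖ ≤ ‖f‖ * ‖g‖ := by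
  have hf := hasSum_norm_sq_hsOp e f
  have hg := hasSum_norm_sq_hsOp e g
  have h := Real.summable_and_inner_le_Lp_mul_Lq_tsum_of_nonneg (p := 2) (q := 2)
    (f := fun i => ‖hsOp f (e i)‖) (g := fun i => ‖hsOp g (e i)‖)
    Real.HolderConjugate.two_two (fun _ => norm_nonneg _) (fun _ => norm_nonneg _)
    (by simpa using hf.summable) (by simpa using hg.summable)
  simp only [norm_tmul2]
  refine ⟨h.1, h.2.trans (le_of_eq ?_)⟩
  simp only [Real.rpow_two]
  rw [hf.tsum_eq, hg.tsum_eq, ← Real.sqrt_eq_rpow, ← Real.sqrt_eq_rpow,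
    Real.sqrt_sq (norm_nonneg _), Real.sqrt_sq (norm_nonneg _)]

theorem hasSum_contr (f g : Tensor2 H) :
    HasSum (fun i => tmul2 (hsOp f (e i)) (hsOp g (e i))) (contr e f g) :=
  (norm_contr_aux e f g).1.of_norm.hasSum

theorem norm_contr_le (f g : Tensor2 H) : ‖contr e f g‖ ≤ ‖f‖ * ‖g‖ :=
  (norm_tsum_le_tsum_norm (norm_contr_aux e f g).1).trans (norm_contr_aux e f g).2

/-- Parseval turns `∑ ⟨A_f eᵢ, u⟩ ⟨A_g eᵢ, v⟩` into `⟨A_f* u, A_g* v⟩`. In particular the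
contraction does not depend on the basis. -/
theorem hsOp_contr (f g : Tensor2 H) :
    hsOp (contr e f g) = hsOp f ∘L ContinuousLinearMap.adjoint (hsOp g) := by
  ext v
  refine ext_inner_right ℝ fun u => ?_
  have h1 : HasSum (fun i => inner ℝ (tmul2 (hsOp f (e i)) (hsOp g (e i))) (tmul2 u v))
      (inner ℝ (contr e f g) (tmul2 u v)) := by
    have := (hasSum_contr e f g).mapL (innerSL ℝ (tmul2 u v))
    simpa only [innerSL_apply_apply, real_inner_comm] using this
  have h2 := e.hasSum_inner_mul_inner (ContinuousLinearMap.adjoint (hsOp f) u)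
    (ContinuousLinearMap.adjoint (hsOp g) v)
  rw [inner_hsOp, ContinuousLinearMap.comp_apply, ← ContinuousLinearMap.adjoint_inner_right,
    real_inner_comm (ContinuousLinearMap.adjoint (hsOp f) u)]
  refine h1.unique (h2.congr_fun fun i => ?_)
  rw [inner_tmul2, ContinuousLinearMap.adjoint_inner_left, ContinuousLinearMap.adjoint_inner_right,
    real_inner_comm u]

/-- The contraction as a bounded bilinear map. -/
noncomputable def contrL : Tensor2 H →L[ℝ] Tensor2 H →L[ℝ] Tensor2 H :=
  LinearMap.mkContinuous₂
    (LinearMap.mk₂ ℝ (contr e)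
      (fun f f' g => hsOp_injective (by simp only [hsOp_contr, hsOp_add]; ext; simp))
      (fun c f g => hsOp_injective (by simp only [hsOp_contr, hsOp_smul]; ext; simp))
      (fun f g g' => hsOp_injective (by simp only [hsOp_contr, hsOp_add]; ext; simp))
      (fun c f g => hsOp_injective (by simp only [hsOp_contr, hsOp_smul]; ext; simp))) 1
    (fun f g => by simpa using norm_contr_le e f g)

theorem contrL_apply (f g : Tensor2 H) : contrL e f g = contr e f g := rfl

theorem contr_tmul2 (a b c d : H) :
    contr e (tmul2 a b) (tmul2 c d) = (inner ℝ b d : ℝ) • tmul2 a c := by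
  apply hsOp_injective
  rw [hsOp_contr, hsOp_smul]
  ext v
  refine ext_inner_right ℝ fun u => ?_
  have h : ContinuousLinearMap.adjoint (hsOp (tmul2 c d)) v = (inner ℝ c v : ℝ) • d := by
    refine ext_inner_right ℝ fun w => ?_
    rw [ContinuousLinearMap.adjoint_inner_left, hsOp_tmul2, inner_smul_right, inner_smul_left]
    simp [real_inner_comm, mul_comm]
  simp only [ContinuousLinearMap.comp_apply, h, map_smul, hsOp_tmul2, smul_apply]
  simp only [inner_smul_left]
  simp
  ring

/-- Self-adjointness removes the adjoint in `hsOp_contr`. The exponents start at one: the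
placeholder `iterContr e f 0 = 0` does not match `hsOp f ^ 0 = 1`. -/
theorem hsOp_iterContr {f : Tensor2 H} (hf : f ∈ symTensor2 H) (r : ℕ) :
    hsOp (iterContr e f (r + 1)) = hsOp f ^ (r + 1) := by
  induction r with
  | zero => simp [iterContr]
  | succ r ih =>
    rw [iterContr, hsOp_contr, ih, mem_symTensor2_iff.mp hf, pow_succ _ (r + 1)]
    rfl

theorem iterContr_mem {f : Tensor2 H} (hf : f ∈ symTensor2 H) (r : ℕ) :
    iterContr e f r ∈ symTensor2 H := by
  cases r with
  | zero => exact zero_mem _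
  | succ r =>
    rw [mem_symTensor2_iff, hsOp_iterContr e hf]
    have h : IsSelfAdjoint (hsOp f) := mem_symTensor2_iff.mp hf
    exact (h.pow (r + 1))

theorem taylorCoeff_eq_coeff (p : Polynomial ℝ) (r : ℕ) : taylorCoeff p r = p.coeff r := by
  rw [taylorCoeff, ← Polynomial.coeff_zero_eq_eval_zero, Polynomial.coeff_iterate_derivative]
  simp [Nat.descFactorial_self]
  field_simp

theorem contrSum_mem {f : Tensor2 H} (hf : f ∈ symTensor2 H) (p : Polynomial ℝ) :
    contrSum e p f ∈ symTensor2 H :=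
  Submodule.sum_mem _ fun r _ => Submodule.smul_mem _ _ (iterContr_mem e hf r)

/-- The constant term has to vanish, since it would contribute a multiple of the identity, which is
not Hilbert-Schmidt in infinite dimension. -/
theorem hsOp_contrSum {f : Tensor2 H} (hf : f ∈ symTensor2 H) {p : Polynomial ℝ}
    (hp : p.coeff 0 = 0) : hsOp (contrSum e p f) = Polynomial.aeval (hsOp f) p := by
  rw [contrSum, ← hsOpL_apply, map_sum, Polynomial.aeval_eq_sum_range, Finset.sum_range_succ',
    hp, zero_smul, add_zero, Finset.range_eq_Ico, Finset.sum_Ico_add' (fun r => p.coeff r • hsOp f ^ r) 0 _ 1]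
  refine Finset.sum_congr (by ext; simp) fun r hr => ?_
  obtain ⟨s, rfl⟩ : ∃ s, r = s + 1 := ⟨r - 1, by simp at hr; omega⟩
  rw [map_smul, hsOpL_apply, hsOp_iterContr e hf, taylorCoeff_eq_coeff]

theorem aeval_apply_eigenvector {E : Type*} [NormedAddCommGroup E] [NormedSpace ℝ E]
    {A : E →L[ℝ] E} {x : E} {c : ℝ} (h : A x = c • x)
    (p : Polynomial ℝ) : Polynomial.aeval A p x = p.eval c • x := by
  have hpow : ∀ n : ℕ, (A ^ n) x = c ^ n • x := fun n => by
    induction n with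
    | zero => simp
    | succ n ih =>
      rw [pow_succ, mul_apply_eq_comp, h, map_smul, ih, smul_smul, pow_succ, mul_comm]
  rw [Polynomial.aeval_eq_sum_range, Polynomial.eval_eq_sum_range, Finset.sum_smul,
    sum_apply]
  refine Finset.sum_congr rfl fun n _ => ?_
  rw [smul_apply, hpow, smul_smul]

/-- The squared norm of a polynomial in a kernel is the sum of the squares of the polynomial over
the eigenvalues of the associated operator. -/
theorem hasSum_norm_sq_contrSum {f : Tensor2 H} (hf : f ∈ symTensor2 H) {p : Polynomial ℝ}
    (hp : p.coeff 0 = 0) {J : Type*} (b : HilbertBasis J ℝ H) {lam : J → ℝ}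
    (hb : ∀ j, hsOp f (b j) = lam j • b j) :
    HasSum (fun j => (p ^ 2).eval (lam j)) (‖contrSum e p f‖ ^ 2) := by
  convert hasSum_norm_sq_hsOp b (contrSum e p f) using 2 with j
  rw [hsOp_contrSum e hf hp, aeval_apply_eigenvector (hb j), norm_smul, b.orthonormal.1 j]
  simp

end Contractions

end WienerChaos

namespace WienerChaos

open scoped ENNReal

/-! ### Variables with moments of all orders -/

section Moments

variable {Ω : Type*} [MeasurableSpace Ω] {P : Measure Ω}

/-- Hölder with exponents `2p`, `2p`, `p`. Requiring all finite exponents at once makes the class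
stable under products, with no exponents to track. -/
theorem memLp_mul_of_forall {f g : Ω → ℝ} (hf : ∀ p : ℝ≥0∞, p ≠ ∞ → MemLp f p P)
    (hg : ∀ p : ℝ≥0∞, p ≠ ∞ → MemLp g p P) (p : ℝ≥0∞) (hp : p ≠ ∞) :
    MemLp (fun ω => f ω * g ω) p P := by
  have : ENNReal.HolderTriple (2 * p) (2 * p) p := ⟨by
    rw [ENNReal.mul_inv (by simp) (by simp), ← add_mul, ENNReal.inv_two_add_inv_two, one_mul]⟩
  exact MemLp.mul' (hg (2 * p) (ENNReal.mul_ne_top (by simp) hp))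
    (hf (2 * p) (ENNReal.mul_ne_top (by simp) hp))

theorem memLp_pow_of_forall [IsFiniteMeasure P] {f : Ω → ℝ}
    (hf : ∀ p : ℝ≥0∞, p ≠ ∞ → MemLp f p P) (n : ℕ) (p : ℝ≥0∞) (hp : p ≠ ∞) :
    MemLp (fun ω => f ω ^ n) p P := by
  induction n generalizing p with
  | zero => simpa using memLp_const 1
  | succ n ih => simpa only [pow_succ] using memLp_mul_of_forall ih hf p hp

/-- A function of temperate growth of a Gaussian vector has moments of all orders. -/
theorem memLp_comp_of_norm_le [IsFiniteMeasure P] {E F : Type*} [NormedAddCommGroup E]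
    [NormedAddCommGroup F] {X : Ω → E} (hX : ∀ p : ℝ≥0∞, p ≠ ∞ → MemLp X p P) {k : E → F}
    (hk : Continuous k) {C : ℝ} {n : ℕ} (hkC : ∀ x, ‖k x‖ ≤ C * (1 + ‖x‖) ^ n)
    (p : ℝ≥0∞) (hp : p ≠ ∞) : MemLp (fun ω => k (X ω)) p P := by
  have h1 : ∀ p : ℝ≥0∞, p ≠ ∞ → MemLp (fun ω => 1 + ‖X ω‖) p P := fun p hp =>
    MemLp.add (f := fun _ => (1 : ℝ)) (memLp_const (1 : ℝ)) (hX p hp).norm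
  have h2 := (memLp_pow_of_forall h1 n p hp).const_mul C
  refine h2.mono (hk.comp_aestronglyMeasurable (hX 0 (by simp)).1) (Filter.Eventually.of_forall ?_)
  intro ω
  exact (hkC _).trans (le_abs_self _)

end Moments

/-! ### One-dimensional Gaussian integration by parts -/

section Stein

/-- Gaussian integration by parts on the line. -/
theorem integral_gaussianReal_deriv {u u' : ℝ → ℝ} (hu : ∀ z, HasDerivAt u (u' z) z)
    (h1 : Integrable u (gaussianReal 0 1)) (h2 : Integrable u' (gaussianReal 0 1))
    (h3 : Integrable (fun z => u z * z) (gaussianReal 0 1)) :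
    ∫ z, u z * z ∂(gaussianReal 0 1) = ∫ z, u' z ∂(gaussianReal 0 1) := by
  have key : ∀ g : ℝ → ℝ, Integrable g (gaussianReal 0 1) →
      Integrable (fun z => g z * gaussianPDFReal 0 1 z) := by
    intro g hg
    rw [gaussianReal_of_var_ne_zero _ one_ne_zero,
      integrable_withDensity_iff_integrable_smul' (measurable_gaussianPDF 0 1)
      (Filter.Eventually.of_forall fun _ => gaussianPDF_lt_top)] at hg
    simpa [toReal_gaussianPDF, mul_comm] using hg
  -- The density solves `v' = -z v`, so the claim is integration by parts for Lebesgue measure.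
  have hv : ∀ z, HasDerivAt (gaussianPDFReal 0 1) (-(z * gaussianPDFReal 0 1 z)) z := by
    intro z
    rw [gaussianPDFReal_def]
    have h : HasDerivAt (fun x : ℝ => -(x - 0) ^ 2 / (2 * ((1 : NNReal) : ℝ))) (-z) z := by
      have := ((((hasDerivAt_id z).sub_const 0).pow 2).neg).div_const (2 * ((1 : NNReal) : ℝ))
      refine this.congr_deriv ?_
      simp
      ring
    have := (h.exp).const_mul ((√(2 * Real.pi * ((1 : NNReal) : ℝ)))⁻¹)
    refine this.congr_deriv ?_
    ring
  have h := integral_mul_deriv_eq_deriv_mul_of_integrable (u := u) (u' := u')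
    (v := gaussianPDFReal 0 1) (v' := fun z => -(z * gaussianPDFReal 0 1 z))
    (fun z _ => hu z) (fun z _ => hv z)
    (by
      have := (key _ h3).neg
      refine this.congr (Filter.Eventually.of_forall fun z => ?_)
      simp only [Pi.neg_apply, Pi.mul_apply]
      ring)
    (key _ h2) (key _ h1)
  rw [integral_gaussianReal_eq_integral_smul one_ne_zero,
    integral_gaussianReal_eq_integral_smul one_ne_zero]
  simp only [smul_eq_mul]
  have e1 : ∀ z, gaussianPDFReal 0 1 z * (u z * z) = -(u z * -(z * gaussianPDFReal 0 1 z)) :=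
    fun z => by ring
  simp only [e1, integral_neg, h, neg_neg]
  simp only [mul_comm]

end Stein

/-! ### Isonormal processes and integration by parts -/

section Isonormal

variable {H : Type*} [NormedAddCommGroup H] [InnerProductSpace ℝ H]
  {Ω : Type*} [MeasurableSpace Ω] {P : Measure Ω} {W : H → Ω → ℝ}

theorem IsIsonormal.memLp (hW : IsIsonormal W P) (h : H) (p : ℝ≥0∞) (hp : p ≠ ∞) :
    MemLp (W h) p P := (hW.gaussian.hasGaussianLaw_eval h).memLp hp

theorem IsIsonormal.measurable (hW : IsIsonormal W P) (h : H) : Measurable (W h) := by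
  rw [measurable_iff_comap_le]
  conv_rhs => rw [hW.generates]
  exact le_iSup (fun h => MeasurableSpace.comap (W h) inferInstance) h

theorem IsIsonormal.memLp_vector (hW : IsIsonormal W P) {ι : Type*} [Fintype ι] (φ : ι → H)
    (p : ℝ≥0∞) (hp : p ≠ ∞) : MemLp (fun ω i => W (φ i) ω) p P :=
  memLp_pi_iff.mpr fun i => hW.memLp (φ i) p hp

theorem IsIsonormal.covariance_eq (hW : IsIsonormal W P) (u v : H) :
    cov[W u, W v; P] = inner ℝ u v := by
  have := hW.gaussian.isProbabilityMeasure
  rw [covariance_eq_sub (hW.memLp u 2 (by simp)) (hW.memLp v 2 (by simp)), hW.centered,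
    hW.centered]
  simpa using hW.covariance u v

theorem IsIsonormal.map_eq (hW : IsIsonormal W P) {h : H} (hh : ‖h‖ = 1) :
    P.map (W h) = gaussianReal 0 1 := by
  rw [(hW.gaussian.hasGaussianLaw_eval h).map_eq_gaussianReal, hW.centered,
    ← covariance_self (hW.measurable h).aemeasurable, hW.covariance_eq,
    real_inner_self_eq_norm_sq, hh]
  simp

theorem IsIsonormal.integrable_mul (hW : IsIsonormal W P) (u v : H) :
    Integrable (fun ω => W u ω * W v ω) P :=
  (hW.memLp u 2 (by simp)).integrable_mul (hW.memLp v 2 (by simp))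

/-- Linearity of `W` is not part of the definition but follows from the covariance: the second
moment of the difference expands to zero. -/
theorem IsIsonormal.combination_ae_eq (hW : IsIsonormal W P) (a b : ℝ) (u v : H) :
    W (a • u + b • v) =ᵐ[P] fun ω => a * W u ω + b * W v ω := by
  set w := a • u + b • v with hw
  have hi := hW.integrable_mul
  have h0 : ∫ ω, (W w ω - (a * W u ω + b * W v ω)) ^ 2 ∂P = 0 := by
    have e : ∀ ω, (W w ω - (a * W u ω + b * W v ω)) ^ 2 =
        W w ω * W w ω + a ^ 2 * (W u ω * W u ω) + b ^ 2 * (W v ω * W v ω)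
          + (-(2 * a)) * (W w ω * W u ω) + (-(2 * b)) * (W w ω * W v ω)
          + (2 * a * b) * (W u ω * W v ω) := fun ω => by ring
    simp only [e]
    rw [integral_add (by fun_prop) (by fun_prop), integral_add (by fun_prop) (by fun_prop),
      integral_add (by fun_prop) (by fun_prop), integral_add (by fun_prop) (by fun_prop),
      integral_add (by fun_prop) (by fun_prop)]
    simp only [integral_const_mul, hW.covariance]
    simp only [hw, inner_add_left, inner_add_right, real_inner_smul_left, real_inner_smul_right]
    rw [real_inner_comm u v]
    ring
  have hint : Integrable (fun ω => (W w ω - (a * W u ω + b * W v ω)) ^ 2) P :=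
    ((hW.memLp w 2 (by simp)).sub (((hW.memLp u 2 (by simp)).const_mul a).add
      ((hW.memLp v 2 (by simp)).const_mul b))).integrable_sq
  rw [integral_eq_zero_iff_of_nonneg (fun ω => sq_nonneg _) hint] at h0
  filter_upwards [h0] with ω hω
  simp only [Pi.zero_apply] at hω
  exact sub_eq_zero.mp (pow_eq_zero_iff two_ne_zero |>.mp hω)

/-- For jointly Gaussian families, zero covariance gives independence; the index type `Sum` presents
both families as one Gaussian process. -/
theorem IsIsonormal.indepFun (hW : IsIsonormal W P) {ι : Type*} (ψ : ι → H) (h : H)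
    (horth : ∀ i, inner ℝ (ψ i) h = (0 : ℝ)) :
    IndepFun (fun ω i => W (ψ i) ω) (W h) P := by
  have hg : IsGaussianProcess (Sum.elim (fun i => W (ψ i)) (fun _ : Unit => W h)) P := by
    refine (hW.gaussian.comp_right (Sum.elim ψ (fun _ : Unit => h))).congr fun t => ?_
    cases t <;> exact Filter.EventuallyEq.rfl
  have := hg.indepFun_of_covariance_eq_zero (fun i => (hW.measurable _).aemeasurable)
    (fun _ => (hW.measurable _).aemeasurable) (fun i _ => by rw [hW.covariance_eq, horth])
  exact this.comp measurable_id (measurable_pi_apply ())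

/-- Gaussian integration by parts in the direction of a unit vector. -/
theorem IsIsonormal.integral_mul_of_norm_eq_one (hW : IsIsonormal W P) {ι : Type*} [Fintype ι]
    (φ : ι → H) {h : H} (hh : ‖h‖ = 1) {k : (ι → ℝ) → ℝ} (hk : Function.HasTemperateGrowth k) :
    ∫ ω, k (fun i => W (φ i) ω) * W h ω ∂P =
      ∫ ω, fderiv ℝ k (fun i => W (φ i) ω) (fun i => inner ℝ (φ i) h) ∂P := by
  have := hW.gaussian.isProbabilityMeasure
  -- Split `φ i = ψ i + c i • h` with `ψ i` orthogonal to `h`. Then the vector `W(φ)` is `Y + W(h)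
  -- c` with `Y` independent of `W(h)`, and for fixed `Y` the one-dimensional formula applies along
  -- the line in direction `c`.
  set c : ι → ℝ := fun i => inner ℝ (φ i) h with hc
  set ψ : ι → H := fun i => φ i - c i • h with hψ
  have hkc : Continuous k := hk.1.continuous
  have hkd : Differentiable ℝ k := hk.1.differentiable (by simp)
  have hk' : Continuous (fderiv ℝ k) := hk.1.continuous_fderiv (by simp)
  let Y : Ω → ι → ℝ := fun ω i => W (ψ i) ω
  have hY : Measurable Y := measurable_pi_lambda _ fun i => hW.measurable _
  have hX : ∀ᵐ ω ∂P, (fun i => W (φ i) ω) = Y ω + W h ω • c := by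
    have : ∀ᵐ ω ∂P, ∀ i, W (φ i) ω = 1 * W (ψ i) ω + c i * W h ω := by
      rw [ae_all_iff]
      intro i
      have := hW.combination_ae_eq 1 (c i) (ψ i) h
      simpa [hψ, Filter.EventuallyEq] using this
    filter_upwards [this] with ω hω
    ext i
    rw [hω i]
    simp [Y, mul_comm]
  have hind : IndepFun Y (W h) P := hW.indepFun ψ h fun i => by
    simp only [hψ, inner_sub_left, real_inner_smul_left, real_inner_self_eq_norm_sq, hh, hc]
    ring
  have hmap : P.map (fun ω => (Y ω, W h ω)) = (P.map Y).prod (gaussianReal 0 1) := by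
    rw [(indepFun_iff_map_prod_eq_prod_map_map hY.aemeasurable
      (hW.measurable h).aemeasurable).mp hind, hW.map_eq hh]
  have hYp : IsProbabilityMeasure (P.map Y) := Measure.isProbabilityMeasure_map hY.aemeasurable
  have hYZ : Measurable (fun ω => (Y ω, W h ω)) := hY.prodMk (hW.measurable h)
  -- transfer of integrals to the product space
  have tr : ∀ G : (ι → ℝ) × ℝ → ℝ, Continuous G → ∀ G' : Ω → ℝ,
      (∀ᵐ ω ∂P, G' ω = G (Y ω, W h ω)) → Integrable G' P →
      Integrable G ((P.map Y).prod (gaussianReal 0 1)) ∧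
        ∫ ω, G' ω ∂P = ∫ y, ∫ z, G (y, z) ∂(gaussianReal 0 1) ∂(P.map Y) := by
    intro G hG G' hae hint
    have h1 : Integrable G ((P.map Y).prod (gaussianReal 0 1)) := by
      rw [← hmap, integrable_map_measure hG.aestronglyMeasurable hYZ.aemeasurable]
      exact hint.congr hae
    refine ⟨h1, ?_⟩
    rw [integral_congr_ae hae, ← integral_prod _ h1, ← hmap,
      integral_map hYZ.aemeasurable hG.aestronglyMeasurable]
  obtain ⟨n0, C0, hC0⟩ := hk.2 0
  obtain ⟨n1, C1, hC1⟩ := hk.2 1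
  have m0 : ∀ p : ℝ≥0∞, p ≠ ∞ → MemLp (fun ω => k (fun i => W (φ i) ω)) p P := fun p hp =>
    memLp_comp_of_norm_le (hW.memLp_vector φ) hkc (fun x => by simpa using hC0 x) p hp
  have m1 : ∀ p : ℝ≥0∞, p ≠ ∞ → MemLp (fun ω => fderiv ℝ k (fun i => W (φ i) ω)) p P :=
    fun p hp => memLp_comp_of_norm_le (hW.memLp_vector φ) hk'
      (fun x => by simpa [norm_iteratedFDeriv_one] using hC1 x) p hp
  have t1 := tr (fun q => k (q.1 + q.2 • c) * q.2) (by fun_prop)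
    (fun ω => k (fun i => W (φ i) ω) * W h ω)
    (by filter_upwards [hX] with ω hω; rw [hω])
    ((m0 2 (by simp)).integrable_mul (hW.memLp h 2 (by simp)))
  have t2 := tr (fun q => fderiv ℝ k (q.1 + q.2 • c) c) (by fun_prop)
    (fun ω => fderiv ℝ k (fun i => W (φ i) ω) c)
    (by filter_upwards [hX] with ω hω; rw [hω])
    (((ContinuousLinearMap.apply ℝ ℝ c).comp_memLp' (m1 1 (by simp))).integrable le_rfl)
  have t3 := tr (fun q => k (q.1 + q.2 • c)) (by fun_prop)
    (fun ω => k (fun i => W (φ i) ω))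
    (by filter_upwards [hX] with ω hω; rw [hω])
    ((m0 1 (by simp)).integrable le_rfl)
  rw [t1.2, t2.2]
  refine integral_congr_ae ?_
  filter_upwards [t1.1.prod_right_ae, t2.1.prod_right_ae, t3.1.prod_right_ae] with y h1 h2 h3
  refine integral_gaussianReal_deriv (fun z => ?_) h3 h2 h1
  have hd : HasDerivAt (fun z : ℝ => y + z • c) c z := by
    simpa using ((hasDerivAt_id z).smul_const c).const_add y
  exact (hkd (y + z • c)).hasFDerivAt.comp_hasDerivAt z hd

/-- Gaussian integration by parts: `E[F W(h)] = E[⟨DF, h⟩]` for smooth cylindrical `F`. -/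
theorem IsIsonormal.integral_mul (hW : IsIsonormal W P) {ι : Type*} [Fintype ι]
    (φ : ι → H) (h : H) {k : (ι → ℝ) → ℝ} (hk : Function.HasTemperateGrowth k) :
    ∫ ω, k (fun i => W (φ i) ω) * W h ω ∂P =
      ∫ ω, fderiv ℝ k (fun i => W (φ i) ω) (fun i => inner ℝ (φ i) h) ∂P := by
  -- A nonzero `h` is rescaled to a unit vector; for `h = 0` both sides vanish because `W(0) = 0`
  -- almost surely.
  by_cases h0 : h = 0
  · subst h0
    have : W (0 : H) =ᵐ[P] fun _ => 0 := by
      simpa using hW.combination_ae_eq 0 0 (0 : H) 0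
    have e : (fun i => inner ℝ (φ i) (0 : H)) = (0 : ι → ℝ) := by ext; simp
    rw [e]
    simp only [map_zero, integral_zero]
    rw [integral_eq_zero_of_ae]
    filter_upwards [this] with ω hω
    simp [hω]
  · have hn : ‖h‖ ≠ 0 := norm_ne_zero_iff.mpr h0
    set h' := ‖h‖⁻¹ • h
    have hh' : ‖h'‖ = 1 := by simp [h', norm_smul, hn]
    have e := hW.combination_ae_eq ‖h‖ 0 h' 0
    have e2 : ‖h‖ • h' = h := by simp [h', smul_smul, hn]
    simp only [smul_zero, add_zero, e2, zero_mul] at e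
    have e3 : (fun i => inner ℝ (φ i) h) = ‖h‖ • (fun i => inner ℝ (φ i) h' : ι → ℝ) := by
      ext i
      conv_lhs => rw [← e2, real_inner_smul_right]
      rfl
    rw [e3]
    simp only [map_smul, smul_eq_mul, integral_const_mul]
    rw [← hW.integral_mul_of_norm_eq_one φ hh' hk, ← integral_const_mul]
    refine integral_congr_ae ?_
    filter_upwards [e] with ω hω
    rw [hω]
    ring

end Isonormal

end WienerChaos

namespace WienerChaos

open scoped ENNReal

/-! ### Density arguments in two tensors, and classes in `L²` -/

section Bilinear

variable {H : Type*} [NormedAddCommGroup H] [InnerProductSpace ℝ H]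

theorem tensor2_induction₂ {p : Tensor2 H → Tensor2 H → Prop}
    (hcl₁ : ∀ t, IsClosed {s | p s t}) (hcl₂ : ∀ s, IsClosed {t | p s t})
    (htmul : ∀ u v u' v', p (tmul2 u v) (tmul2 u' v'))
    (hadd₁ : ∀ s s' t, p s t → p s' t → p (s + s') t)
    (hadd₂ : ∀ s t t', p s t → p s t' → p s (t + t')) (s t : Tensor2 H) : p s t :=
  tensor2_induction (p := fun s => p s t) (hcl₁ t)
    (fun u v => tensor2_induction (p := fun t => p (tmul2 u v) t) (hcl₂ _)
      (fun u' v' => htmul u v u' v') (fun t t' => hadd₂ _ t t') t)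
    (fun s s' => hadd₁ s s' t) s

end Bilinear

section ToL2

variable {Ω : Type*} [MeasurableSpace Ω] {P : Measure Ω}

theorem coeFn_toL2 {X : Ω → ℝ} (hX : MemLp X 2 P) : toL2 P X =ᵐ[P] X := by
  rw [toL2, dif_pos hX]
  exact hX.coeFn_toLp

theorem toL2_eq_iff {X : Ω → ℝ} (hX : MemLp X 2 P) (Y : Lp ℝ 2 P) : toL2 P X = Y ↔ X =ᵐ[P] Y := by
  rw [Lp.ext_iff]
  exact ⟨fun h => (coeFn_toL2 hX).symm.trans h, fun h => (coeFn_toL2 hX).trans h⟩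

theorem inner_L2_eq_integral {F G : Lp ℝ 2 P} {X Y : Ω → ℝ} (hF : F =ᵐ[P] X) (hG : G =ᵐ[P] Y) :
    inner ℝ F G = ∫ ω, X ω * Y ω ∂P := by
  rw [L2.inner_def]
  refine integral_congr_ae ?_
  filter_upwards [hF, hG] with ω h1 h2
  rw [h1, h2]
  simp [mul_comm]

end ToL2

/-! ### The Wick product map and the double integral -/

section Wick

variable {H : Type*} [NormedAddCommGroup H] [InnerProductSpace ℝ H]
  {Ω : Type*} [MeasurableSpace Ω] {P : Measure Ω} {W : H → Ω → ℝ}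

theorem IsIsonormal.memLp_mul (hW : IsIsonormal W P) (u v : H) (p : ℝ≥0∞) (hp : p ≠ ∞) :
    MemLp (fun ω => W u ω * W v ω) p P :=
  memLp_mul_of_forall (hW.memLp u) (hW.memLp v) p hp

/-- Isserlis' formula: integrating the monomial `x₀ x₁ x₂` by parts against `W a` leaves second
moments. -/
theorem IsIsonormal.integral_mul_mul_mul (hW : IsIsonormal W P) (a b c d : H) :
    ∫ ω, (W b ω * W c ω * W d ω) * W a ω ∂P =
      inner ℝ b a * inner ℝ c d + inner ℝ c a * inner ℝ b d + inner ℝ d a * inner ℝ b c := by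
  have hk : Function.HasTemperateGrowth (fun x : Fin 3 → ℝ => x 0 * x 1 * x 2) := by
    have hp : ∀ i : Fin 3, Function.HasTemperateGrowth (fun x : Fin 3 → ℝ => x i) := fun i =>
      (ContinuousLinearMap.proj (R := ℝ) (φ := fun _ : Fin 3 => ℝ) i).hasTemperateGrowth
    exact ((hp 0).mul (hp 1)).mul (hp 2)
  have hd : ∀ x v : Fin 3 → ℝ, fderiv ℝ (fun x : Fin 3 → ℝ => x 0 * x 1 * x 2) x v =
      v 0 * (x 1 * x 2) + v 1 * (x 0 * x 2) + v 2 * (x 0 * x 1) := by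
    intro x v
    have hp : ∀ i : Fin 3, HasFDerivAt (fun x : Fin 3 → ℝ => x i)
        (ContinuousLinearMap.proj (R := ℝ) (φ := fun _ : Fin 3 => ℝ) i) x := fun i =>
      (ContinuousLinearMap.proj (R := ℝ) (φ := fun _ : Fin 3 => ℝ) i).hasFDerivAt
    rw [(((hp 0).fun_mul (hp 1)).fun_mul (hp 2)).fderiv]
    simp
    ring
  have h := hW.integral_mul ![b, c, d] a hk
  simp only [hd] at h
  simp only [Matrix.cons_val] at h
  rw [h]
  have hi := hW.integrable_mul
  rw [integral_add (by fun_prop) (by fun_prop), integral_add (by fun_prop) (by fun_prop)]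
  simp only [integral_const_mul, hW.covariance]

/-- The bilinear map `(u, v) ↦ W(u) W(v) - ⟨u, v⟩`. -/
noncomputable def wickB (hW : IsIsonormal W P) : H →ₗ[ℝ] H →ₗ[ℝ] Lp ℝ 2 P :=
  have := hW.gaussian.isProbabilityMeasure
  have hm : ∀ u v, MemLp (fun ω => W u ω * W v ω - inner ℝ u v) 2 P := fun u v =>
    (hW.memLp_mul u v 2 (by simp)).sub (memLp_const _)
  have hadd : ∀ u u', W (u + u') =ᵐ[P] fun ω => W u ω + W u' ω := fun u u' => by
    simpa using hW.combination_ae_eq 1 1 u u'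
  have hsmul : ∀ (c : ℝ) u, W (c • u) =ᵐ[P] fun ω => c * W u ω := fun c u => by
    simpa using hW.combination_ae_eq c 0 u 0
  LinearMap.mk₂ ℝ (fun u v => toL2 P (fun ω => W u ω * W v ω - inner ℝ u v))
    (fun u u' v => by
      rw [toL2_eq_iff (hm _ _)]
      filter_upwards [hadd u u', coeFn_toL2 (hm u v), coeFn_toL2 (hm u' v),
        Lp.coeFn_add (toL2 P (fun ω => W u ω * W v ω - inner ℝ u v))
          (toL2 P (fun ω => W u' ω * W v ω - inner ℝ u' v))] with ω h1 h2 h3 h4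
      rw [h4, Pi.add_apply, h2, h3, h1, inner_add_left]
      ring)
    (fun c u v => by
      rw [toL2_eq_iff (hm _ _)]
      filter_upwards [hsmul c u, coeFn_toL2 (hm u v),
        Lp.coeFn_smul c (toL2 P (fun ω => W u ω * W v ω - inner ℝ u v))] with ω h1 h2 h4
      rw [h4, Pi.smul_apply, h2, h1, real_inner_smul_left, smul_eq_mul]
      ring)
    (fun u v v' => by
      rw [toL2_eq_iff (hm _ _)]
      filter_upwards [hadd v v', coeFn_toL2 (hm u v), coeFn_toL2 (hm u v'),
        Lp.coeFn_add (toL2 P (fun ω => W u ω * W v ω - inner ℝ u v))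
          (toL2 P (fun ω => W u ω * W v' ω - inner ℝ u v'))] with ω h1 h2 h3 h4
      rw [h4, Pi.add_apply, h2, h3, h1, inner_add_right]
      ring)
    (fun c u v => by
      rw [toL2_eq_iff (hm _ _)]
      filter_upwards [hsmul c v, coeFn_toL2 (hm u v),
        Lp.coeFn_smul c (toL2 P (fun ω => W u ω * W v ω - inner ℝ u v))] with ω h1 h2 h4
      rw [h4, Pi.smul_apply, h2, h1, real_inner_smul_right, smul_eq_mul]
      ring)

theorem wickB_ae_eq (hW : IsIsonormal W P) (u v : H) :
    wickB hW u v =ᵐ[P] fun ω => W u ω * W v ω - inner ℝ u v := by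
  have := hW.gaussian.isProbabilityMeasure
  exact coeFn_toL2 ((hW.memLp_mul u v 2 (by simp)).sub (memLp_const _))

/-- Of the three pairings in Isserlis' formula, the one inside each factor is cancelled by
subtracting the means. -/
theorem inner_wickB (hW : IsIsonormal W P) (u v u' v' : H) :
    inner ℝ (wickB hW u v) (wickB hW u' v') =
      inner ℝ u u' * inner ℝ v v' + inner ℝ u v' * inner ℝ v u' := by
  have := hW.gaussian.isProbabilityMeasure
  rw [inner_L2_eq_integral (wickB_ae_eq hW u v) (wickB_ae_eq hW u' v')]
  have hi := hW.integrable_mul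
  have e : ∀ ω, (W u ω * W v ω - inner ℝ u v) * (W u' ω * W v' ω - inner ℝ u' v') =
      (W v ω * W u' ω * W v' ω) * W u ω + (-inner ℝ u' v') * (W u ω * W v ω)
        + (-inner ℝ u v) * (W u' ω * W v' ω) + inner ℝ u v * inner ℝ u' v' := fun ω => by ring
  have h4 : Integrable (fun ω => (W v ω * W u' ω * W v' ω) * W u ω) P :=
    ((memLp_mul_of_forall (fun p hp => memLp_mul_of_forall
      (fun p hp => hW.memLp_mul v u' p hp) (hW.memLp v') p hp) (hW.memLp u) 1 (by simp))).integrable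
      le_rfl
  simp only [e]
  rw [integral_add (by fun_prop) (by fun_prop), integral_add (by fun_prop) (by fun_prop),
    integral_add (by fun_prop) (by fun_prop), hW.integral_mul_mul_mul]
  simp only [integral_const_mul, hW.covariance, integral_const, probReal_univ, smul_eq_mul]
  rw [real_inner_comm u v, real_inner_comm u u', real_inner_comm u v']
  ring

theorem inner_lift_wickB (hW : IsIsonormal W P) (s t : H ⊗[ℝ] H) :
    inner ℝ (TensorProduct.lift (wickB hW) s) (TensorProduct.lift (wickB hW) t) =
      inner ℝ s t + inner ℝ s (TensorProduct.comm ℝ H H t) := by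
  induction s using TensorProduct.induction_on with
  | zero => simp
  | add s s' hs hs' => simp only [map_add, inner_add_left, hs, hs']; ring
  | tmul u v =>
    induction t using TensorProduct.induction_on with
    | zero => simp
    | add s s' hs hs' => simp only [map_add, inner_add_right, hs, hs']; ring
    | tmul u' v' => simp [inner_wickB]

/-- The two surviving pairings contribute `⟨t, t⟩` and `⟨t, τ t⟩`, with `τ` the exchange, each at
most `‖t‖ ^ 2`. Symmetric tensors attain the bound, whence the norm `√2 ‖·‖`. -/
theorem norm_lift_wickB_le (hW : IsIsonormal W P) (t : H ⊗[ℝ] H) :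
    ‖TensorProduct.lift (wickB hW) t‖ ≤ √2 * ‖t‖ := by
  refine le_of_sq_le_sq ?_ (by positivity)
  rw [mul_pow, Real.sq_sqrt (by norm_num), ← real_inner_self_eq_norm_sq, inner_lift_wickB]
  have h1 : inner ℝ t t = ‖t‖ ^ 2 := real_inner_self_eq_norm_sq t
  have h2 : inner ℝ t (TensorProduct.comm ℝ H H t) ≤ ‖t‖ * ‖TensorProduct.comm ℝ H H t‖ :=
    real_inner_le_norm t (TensorProduct.comm ℝ H H t)
  rw [TensorProduct.norm_comm] at h2
  rw [h1]
  linarith [sq ‖t‖]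

/-- The Wick product map `u ⊗ v ↦ W(u) W(v) - ⟨u, v⟩` on the whole tensor square. -/
noncomputable def wickL (hW : IsIsonormal W P) : Tensor2 H →L[ℝ] Lp ℝ 2 P := tensor2Lift (wickB hW)

theorem wickL_tmul2 (hW : IsIsonormal W P) (u v : H) :
    wickL hW (tmul2 u v) =ᵐ[P] fun ω => W u ω * W v ω - inner ℝ u v := by
  rw [wickL, tensor2Lift_tmul2 _ _ (norm_lift_wickB_le hW)]
  exact wickB_ae_eq hW u v

theorem inner_wickL (hW : IsIsonormal W P) (s t : Tensor2 H) :
    inner ℝ (wickL hW s) (wickL hW t) = inner ℝ s t + inner ℝ s (swap2 t) := by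
  refine tensor2_induction₂
    (p := fun s t => inner ℝ (wickL hW s) (wickL hW t) = inner ℝ s t + inner ℝ s (swap2 t))
    (fun t => isClosed_eq (by fun_prop) (by fun_prop))
    (fun s => isClosed_eq (by fun_prop) (by fun_prop)) (fun u v u' v' => ?_)
    (fun s s' t h h' => ?_) (fun s t t' h h' => ?_) s t
  · simp only [swap2_tmul2, inner_tmul2, wickL, tensor2Lift_tmul2 _ _ (norm_lift_wickB_le hW),
      inner_wickB]
  · simp only [map_add, inner_add_left, h, h']
    ring
  · simp only [map_add, inner_add_right, h, h']
    ring

theorem norm_wickL (hW : IsIsonormal W P) {f : Tensor2 H} (hf : f ∈ symTensor2 H) :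
    ‖wickL hW f‖ = √2 * ‖f‖ := by
  rw [← sq_eq_sq₀ (norm_nonneg _) (by positivity), mul_pow, Real.sq_sqrt (by norm_num),
    ← real_inner_self_eq_norm_sq, inner_wickL, swap2_eq_self hf, real_inner_self_eq_norm_sq]
  ring

theorem hermite_two_eval (x : ℝ) : Polynomial.aeval x (Polynomial.hermite 2) = x ^ 2 - 1 := by
  simp [Polynomial.hermite_succ]
  ring

theorem isDoubleIntegral_wickL (hW : IsIsonormal W P) :
    IsDoubleIntegral W P ((wickL hW).comp (symTensor2 H).subtypeL) := by
  refine ⟨fun f => norm_wickL hW f.2, fun h hh => ?_⟩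
  refine (wickL_tmul2 hW h h).trans (Filter.Eventually.of_forall fun ω => ?_)
  simp only [hermiteRV, hermite_two_eval, real_inner_self_eq_norm_sq, hh]
  ring

/-- `wickL` witnesses existence, so `doubleIntegral` is not its default value `0`. The map picked by
choice agrees with it because a bounded map is determined by the squares of unit vectors. -/
theorem doubleIntegral_eq (hW : IsIsonormal W P) :
    doubleIntegral W P = (wickL hW).comp (symTensor2 H).subtypeL := by
  have hex : ∃ I, IsDoubleIntegral W P I := ⟨_, isDoubleIntegral_wickL hW⟩
  rw [doubleIntegral, dif_pos hex]
  refine symTensor2_clm_ext fun u hu => Lp.ext ?_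
  exact (hex.choose_spec.2 u hu).trans ((isDoubleIntegral_wickL hW).2 u hu).symm

theorem doubleIntegral_apply (hW : IsIsonormal W P) (f : symTensor2 H) :
    doubleIntegral W P f = wickL hW f := by
  rw [doubleIntegral_eq hW]
  rfl

theorem wickL_swap2 (hW : IsIsonormal W P) (t : Tensor2 H) : wickL hW (swap2 t) = wickL hW t := by
  have : (wickL hW).comp swap2 = wickL hW := by
    refine tensor2_clm_ext fun u v => Lp.ext ?_
    rw [ContinuousLinearMap.comp_apply, swap2_tmul2]
    filter_upwards [wickL_tmul2 hW u v, wickL_tmul2 hW v u] with ω h1 h2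
    rw [h1, h2, real_inner_comm]
    ring
  exact congrArg (fun T => T t) this

/-- A closed subspace that contains the `W(g)² - ‖g‖²` contains all Wick products. -/
theorem wickL_mem (hW : IsIsonormal W P) {M : Submodule ℝ (Lp ℝ 2 P)}
    (hM : IsClosed (M : Set (Lp ℝ 2 P))) (h : ∀ g, wickL hW (tmul2 g g) ∈ M) (t : Tensor2 H) :
    wickL hW t ∈ M := by
  refine tensor2_induction (p := fun t => wickL hW t ∈ M)
    (hM.preimage (wickL hW).continuous) (fun u v => ?_) (fun s t hs ht => ?_) t
  · have e : wickL hW (tmul2 u v) = (1 / 2 : ℝ) • wickL hW (tmul2 u v + tmul2 v u) := by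
      rw [map_add, ← swap2_tmul2 u v, wickL_swap2]
      module
    rw [e, tmul2_polarization, map_smul, map_sub]
    exact M.smul_mem _ (M.smul_mem _ (M.sub_mem (h _) (h _)))
  · rw [map_add]
    exact M.add_mem hs ht

/-- The constant random variable `1`. -/
noncomputable def oneL2 (P : Measure Ω) : Lp ℝ 2 P := toL2 P (fun _ => 1)

theorem oneL2_ae_eq [IsFiniteMeasure P] : oneL2 P =ᵐ[P] fun _ => 1 := coeFn_toL2 (memLp_const 1)

theorem integral_eq_inner_oneL2 [IsFiniteMeasure P] (X : Lp ℝ 2 P) :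
    ∫ ω, X ω ∂P = inner ℝ X (oneL2 P) := by
  rw [inner_L2_eq_integral (Filter.EventuallyEq.refl _ X) oneL2_ae_eq]
  simp

theorem integral_wickL (hW : IsIsonormal W P) (t : Tensor2 H) : ∫ ω, wickL hW t ω ∂P = 0 := by
  have := hW.gaussian.isProbabilityMeasure
  have h : (innerSL ℝ (oneL2 P)).comp (wickL hW) = 0 := by
    refine tensor2_clm_ext fun u v => ?_
    rw [ContinuousLinearMap.comp_apply, innerSL_apply_apply,
      inner_L2_eq_integral oneL2_ae_eq (wickL_tmul2 hW u v)]
    simp only [one_mul]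
    rw [integral_sub (hW.integrable_mul u v) (integrable_const _), hW.covariance]
    simp
  rw [integral_eq_inner_oneL2, real_inner_comm]
  exact congrArg (fun T => T t) h

end Wick

/-! ### Wiener chaoses and the pseudo-inverse -/

section Chaos

variable {H : Type*} [NormedAddCommGroup H] [InnerProductSpace ℝ H]
  {Ω : Type*} [MeasurableSpace Ω] {P : Measure Ω} {W : H → Ω → ℝ}

theorem IsIsonormal.memLp_eval (hW : IsIsonormal W P) (p : Polynomial ℝ) (h : H)
    (q : ℝ≥0∞) (hq : q ≠ ∞) : MemLp (fun ω => p.eval (W h ω)) q P := by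
  have := hW.gaussian.isProbabilityMeasure
  simp only [Polynomial.eval_eq_sum_range]
  exact memLp_finsetSum _ fun i _ => (memLp_pow_of_forall (hW.memLp h) i q hq).const_mul _

theorem hasTemperateGrowth_eval_apply {ι : Type*} [Fintype ι] (p : Polynomial ℝ) (i : ι) :
    Function.HasTemperateGrowth (fun x : ι → ℝ => p.eval (x i)) := by
  have hp : Function.HasTemperateGrowth (fun x : ι → ℝ => x i) :=
    (ContinuousLinearMap.proj (R := ℝ) (φ := fun _ : ι => ℝ) i).hasTemperateGrowth
  simp only [Polynomial.eval_eq_sum_range]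
  exact Function.HasTemperateGrowth.sum fun n _ =>
    (Function.HasTemperateGrowth.const _).mul (hp.pow n)

theorem IsIsonormal.integral_eval_mul_eval_mul (hW : IsIsonormal W P) {h : H} (hh : ‖h‖ = 1) (g : H)
    (p r : Polynomial ℝ) :
    ∫ ω, (r.eval (W h ω) * p.eval (W g ω)) * W h ω ∂P =
      ∫ ω, r.derivative.eval (W h ω) * p.eval (W g ω) ∂P +
        inner ℝ g h * ∫ ω, r.eval (W h ω) * p.derivative.eval (W g ω) ∂P := by
  have hk : Function.HasTemperateGrowth (fun x : Fin 2 → ℝ => r.eval (x 0) * p.eval (x 1)) :=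
    (hasTemperateGrowth_eval_apply r 0).mul (hasTemperateGrowth_eval_apply p 1)
  have hd : ∀ x v : Fin 2 → ℝ, fderiv ℝ (fun x : Fin 2 → ℝ => r.eval (x 0) * p.eval (x 1)) x v =
      v 0 * (r.derivative.eval (x 0) * p.eval (x 1)) +
        v 1 * (r.eval (x 0) * p.derivative.eval (x 1)) := by
    intro x v
    have hp : ∀ (q : Polynomial ℝ) (i : Fin 2), HasFDerivAt (fun x : Fin 2 → ℝ => q.eval (x i))
        (q.derivative.eval (x i) • ContinuousLinearMap.proj (R := ℝ) (φ := fun _ : Fin 2 => ℝ) i)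
        x := fun q i =>
      HasDerivAt.comp_hasFDerivAt (f := fun x : Fin 2 → ℝ => x i) x (q.hasDerivAt (x i))
        (ContinuousLinearMap.proj (R := ℝ) (φ := fun _ : Fin 2 => ℝ) i).hasFDerivAt
    rw [((hp r 0).fun_mul (hp p 1)).fderiv]
    simp
    ring
  have := hW.integral_mul ![h, g] h hk
  simp only [hd] at this
  simp only [Matrix.cons_val] at this
  rw [this, integral_add, integral_const_mul, integral_const_mul, real_inner_self_eq_norm_sq, hh]
  · ring
  all_goals
    exact ((hW.memLp_eval _ _ 2 (by simp)).integrable_mul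
      (hW.memLp_eval _ _ 2 (by simp))).const_mul _

/-- `E[H_q(W(h)) p(W(g))] = ⟨g, h⟩^q E[p^{(q)}(W(g))]`. -/
theorem IsIsonormal.integral_hermite_mul (hW : IsIsonormal W P) {h : H} (hh : ‖h‖ = 1) (g : H)
    (q : ℕ) (p : Polynomial ℝ) :
    ∫ ω, hermiteRV W q h ω * p.eval (W g ω) ∂P =
      inner ℝ g h ^ q * ∫ ω, (Polynomial.derivative^[q] p).eval (W g ω) ∂P := by
  induction q generalizing p with
  | zero => simp [hermiteRV]
  | succ q ih =>
    set r : Polynomial ℝ := (Polynomial.hermite q).map (Int.castRingHom ℝ) with hr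
    have hrv : ∀ ω, hermiteRV W q h ω = r.eval (W h ω) := fun ω => by
      simp [hermiteRV, hr, Polynomial.aeval_def, Polynomial.eval_map]
    -- The recursion `H_{q+1} = x H_q - H_q'`: integrating `x H_q` by parts cancels the `H_q'` term
    -- and moves one derivative to `p`, with a factor `⟨g, h⟩`.
    have e : ∀ ω, hermiteRV W (q + 1) h ω * p.eval (W g ω) =
        (r.eval (W h ω) * p.eval (W g ω)) * W h ω - r.derivative.eval (W h ω) * p.eval (W g ω) := by
      intro ω
      simp only [hermiteRV, Polynomial.hermite_succ, map_sub, map_mul, Polynomial.eval₂_X, hr,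
        Polynomial.derivative_map, Polynomial.eval_map, Polynomial.aeval_def, algebraMap_int_eq]
      ring
    have hm : ∀ s t : Polynomial ℝ, Integrable (fun ω => s.eval (W h ω) * t.eval (W g ω)) P :=
      fun s t => (hW.memLp_eval _ _ 2 (by simp)).integrable_mul (hW.memLp_eval _ _ 2 (by simp))
    have hm3 : Integrable (fun ω => (r.eval (W h ω) * p.eval (W g ω)) * W h ω) P := by
      refine (hm (r * Polynomial.X) p).congr (Filter.Eventually.of_forall fun ω => ?_)
      simp only [Polynomial.eval_mul, Polynomial.eval_X]
      ring
    simp only [e]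
    rw [integral_sub hm3 (hm _ _), hW.integral_eval_mul_eval_mul hh, add_sub_cancel_left]
    have := ih (Polynomial.derivative p)
    simp only [hrv] at this
    rw [this, Function.iterate_succ_apply, pow_succ]
    ring

theorem mem_chaos_orthogonal {H : Type*} [NormedAddCommGroup H] {W : H → Ω → ℝ}
    (q : ℕ) {X : Lp ℝ 2 P}
    (h : ∀ Y : Lp ℝ 2 P, (∃ h : H, ‖h‖ = 1 ∧ Y =ᵐ[P] hermiteRV W q h) → inner ℝ Y X = 0) :
    X ∈ (chaos W P q)ᗮ := by
  rw [chaos, Submodule.orthogonal_closure, Submodule.mem_orthogonal]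
  intro Y hY
  induction hY using Submodule.span_induction with
  | mem Y hY => exact h Y hY
  | zero => simp
  | add Y Z _ _ hY hZ => rw [inner_add_left, hY, hZ, add_zero]
  | smul c Y _ hY => rw [real_inner_smul_left, hY, mul_zero]

theorem oneL2_mem_chaos_orthogonal (hW : IsIsonormal W P) {q : ℕ} (hq : q ≠ 0) :
    oneL2 P ∈ (chaos W P q)ᗮ := by
  have := hW.gaussian.isProbabilityMeasure
  refine mem_chaos_orthogonal q fun Y ⟨h, hh, hY⟩ => ?_
  rw [inner_L2_eq_integral hY oneL2_ae_eq]
  have := hW.integral_hermite_mul hh h q 1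
  obtain ⟨n, rfl⟩ := Nat.exists_eq_succ_of_ne_zero hq
  simpa using this

theorem wickL_tmul2_self (hW : IsIsonormal W P) (g : H) :
    wickL hW (tmul2 g g) =ᵐ[P]
      fun ω => (Polynomial.X ^ 2 - Polynomial.C (‖g‖ ^ 2) : Polynomial ℝ).eval (W g ω) := by
  filter_upwards [wickL_tmul2 hW g g] with ω hω
  rw [hω, real_inner_self_eq_norm_sq]
  simp
  ring

/-- By `integral_hermite_mul` the inner product involves the `q`-th derivative of `x² - ‖g‖²`: for
`q = 1` this is `2x`, of mean zero, and for `q ≥ 3` it vanishes. Orthogonality of the chaoses in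
general is not needed. -/
theorem wickL_mem_chaos_orthogonal (hW : IsIsonormal W P) {q : ℕ} (hq : q ≠ 0) (hq2 : q ≠ 2)
    (t : Tensor2 H) : wickL hW t ∈ (chaos W P q)ᗮ := by
  refine wickL_mem hW (Submodule.isClosed_orthogonal _) (fun g => ?_) t
  refine mem_chaos_orthogonal q fun Y ⟨h, hh, hY⟩ => ?_
  rw [inner_L2_eq_integral hY (wickL_tmul2_self hW g), hW.integral_hermite_mul hh]
  obtain rfl | hq3 : q = 1 ∨ 3 ≤ q := by omega
  · simp only [Function.iterate_one, Polynomial.derivative_sub, Polynomial.derivative_C, sub_zero,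
      Polynomial.derivative_X_pow, Polynomial.eval_mul, Polynomial.eval_C, integral_const_mul]
    simp [hW.centered]
  · rw [Polynomial.iterate_derivative_eq_zero]
    · simp
    · refine lt_of_le_of_lt (Polynomial.natDegree_sub_le _ _) ?_
      simp
      omega

theorem wickL_mem_chaos_two (hW : IsIsonormal W P) (t : Tensor2 H) :
    wickL hW t ∈ chaos W P 2 := by
  refine wickL_mem hW (Submodule.isClosed_topologicalClosure _) (fun g => ?_) t
  refine Submodule.le_topologicalClosure _ ?_
  by_cases hg : g = 0
  · subst hg
    have : tmul2 (0 : H) 0 = 0 := by simp [tmul2]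
    rw [this, map_zero]
    exact zero_mem _
  · have hn : ‖g‖ ≠ 0 := norm_ne_zero_iff.mpr hg
    have e : tmul2 g g = ‖g‖ ^ 2 • tmul2 (‖g‖⁻¹ • g) (‖g‖⁻¹ • g) := by
      rw [tmul2_smul_smul, smul_smul]
      simp [hn]
    rw [e, map_smul]
    refine Submodule.smul_mem _ _ (Submodule.subset_span ⟨‖g‖⁻¹ • g, by simp [norm_smul, hn], ?_⟩)
    have h1 : ‖‖g‖⁻¹ • g‖ = 1 := by simp [norm_smul, hn]
    exact (isDoubleIntegral_wickL hW).2 _ h1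

theorem chaosProj_eq_zero {H : Type*} [NormedAddCommGroup H] {W : H → Ω → ℝ} {q : ℕ} {X : Lp ℝ 2 P} (hX : X ∈ (chaos W P q)ᗮ) :
    chaosProj W P q X = 0 :=
  Submodule.eq_starProjection_of_mem_orthogonal (zero_mem _) (by simpa using hX)

/-- The pseudo-inverse of the generator on the sum of the chaoses of orders `0` and `2`. -/
theorem pseudoInv_wickL (hW : IsIsonormal W P) (t : Tensor2 H) (c : ℝ) :
    pseudoInv W P (wickL hW t + c • oneL2 P) = (-(1 / 2 : ℝ)) • wickL hW t := by
  have h0 : ∀ q : ℕ, chaosProj W P (q + 1) (oneL2 P) = 0 := fun q =>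
    chaosProj_eq_zero (oneL2_mem_chaos_orthogonal hW (by omega))
  -- The term of index `q` concerns the chaos of order `q + 1`, so only index `1` survives, with
  -- coefficient `-1/2`.
  rw [pseudoInv, tsum_eq_single 1]
  · rw [map_add, map_smul, h0, smul_zero, add_zero]
    have : chaosProj W P (1 + 1) (wickL hW t) = wickL hW t :=
      Submodule.starProjection_eq_self_iff.mpr (wickL_mem_chaos_two hW t)
    rw [this]
    norm_num
  · intro q hq
    rw [map_add, map_smul, h0, smul_zero, add_zero]
    have : chaosProj W P (q + 1) (wickL hW t) = 0 :=
      chaosProj_eq_zero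
        (wickL_mem_chaos_orthogonal hW (by omega) (by omega) t)
    rw [this, smul_zero]

end Chaos

end WienerChaos

namespace WienerChaos

open scoped ENNReal

/-! ### Totality of the trigonometric functions of the process -/

section Totality

variable {H : Type*} [NormedAddCommGroup H] [InnerProductSpace ℝ H]
  {Ω : Type*} [mΩ : MeasurableSpace Ω] {P : Measure Ω} {W : H → Ω → ℝ}

theorem IsIsonormal.sum_ae_eq (hW : IsIsonormal W P) {ι : Type*} (s : Finset ι) (c : ι → ℝ)
    (φ : ι → H) : W (∑ i ∈ s, c i • φ i) =ᵐ[P] fun ω => ∑ i ∈ s, c i * W (φ i) ω := by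
  classical
  induction s using Finset.induction_on with
  | empty => simpa using hW.combination_ae_eq 0 0 (0 : H) 0
  | insert a s ha ih =>
    filter_upwards [ih, hW.combination_ae_eq (c a) 1 (φ a) (∑ i ∈ s, c i • φ i)] with ω h1 h2
    rw [Finset.sum_insert ha, Finset.sum_insert ha, ← h1]
    simpa using h2

/-- An integrable random variable that is orthogonal to all the `cos W(u)` and `sin W(u)`
vanishes. -/
theorem IsIsonormal.ae_eq_zero_of_integral_trig (hW : IsIsonormal W P) {X : Ω → ℝ}
    (hX : Integrable X P) (hcos : ∀ u, ∫ ω, X ω * Real.cos (W u ω) ∂P = 0)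
    (hsin : ∀ u, ∫ ω, X ω * Real.sin (W u ω) ∂P = 0) : X =ᵐ[P] 0 := by
  classical
  have := hW.gaussian.isProbabilityMeasure
  -- `μ` and `ν` have the positive and negative parts of `X` as densities. The hypotheses say that
  -- they give the process the same characteristic functions, hence the same finite-dimensional
  -- laws; so `μ = ν` on the sigma-algebra generated by `W`, which is the whole one.
  set μ := P.withDensity (fun ω => ENNReal.ofReal (X ω)) with hμ
  set ν := P.withDensity (fun ω => ENNReal.ofReal (-X ω)) with hν
  have : IsFiniteMeasure μ := isFiniteMeasure_withDensity_ofReal hX.2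
  have : IsFiniteMeasure ν := isFiniteMeasure_withDensity_ofReal hX.neg.2
  have hmeas : ∀ u, Measurable (fun ω => Complex.exp (W u ω * Complex.I)) := fun u => by
    have := hW.measurable u
    fun_prop
  have hexp : ∀ u, ∫ ω, Complex.exp (W u ω * Complex.I) ∂μ =
      ∫ ω, Complex.exp (W u ω * Complex.I) ∂ν := by
    intro u
    rw [hμ, hν, integral_withDensity_eq_integral_toReal_smul₀ (by fun_prop) (by simp),
      integral_withDensity_eq_integral_toReal_smul₀ (by fun_prop) (by simp), ← sub_eq_zero,
      ← integral_sub]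
    · have hc : Integrable (fun ω => X ω * Real.cos (W u ω)) P :=
        hX.mul_bdd (c := 1) (by have := hW.measurable u; fun_prop)
          (Filter.Eventually.of_forall fun ω => Real.abs_cos_le_one _)
      have hs : Integrable (fun ω => X ω * Real.sin (W u ω)) P :=
        hX.mul_bdd (c := 1) (by have := hW.measurable u; fun_prop)
          (Filter.Eventually.of_forall fun ω => Real.abs_sin_le_one _)
      have e : ∀ ω, (ENNReal.ofReal (X ω)).toReal • Complex.exp (W u ω * Complex.I) -
          (ENNReal.ofReal (-X ω)).toReal • Complex.exp (W u ω * Complex.I) =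
          ((X ω * Real.cos (W u ω) : ℝ) : ℂ) + ((X ω * Real.sin (W u ω) : ℝ) : ℂ) * Complex.I := by
        intro ω
        have hx : (ENNReal.ofReal (X ω)).toReal - (ENNReal.ofReal (-X ω)).toReal = X ω := by
          rw [ENNReal.toReal_ofReal', ENNReal.toReal_ofReal']
          rcases le_total 0 (X ω) with h | h
          · rw [max_eq_left h, max_eq_right (by linarith)]; ring
          · rw [max_eq_right h, max_eq_left (by linarith)]; ring
        rw [← sub_smul, hx, Complex.exp_mul_I, Complex.real_smul]
        push_cast
        ring
      simp only [e]
      rw [integral_add hc.ofReal (hs.ofReal.mul_const _), integral_mul_const, integral_complex_ofReal,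
        integral_complex_ofReal, hcos, hsin]
      simp
    · refine (Integrable.bdd_mul (c := 1) hX.pos_part.ofReal (hmeas u).aestronglyMeasurable
        (Filter.Eventually.of_forall fun ω => ?_)).congr (Filter.Eventually.of_forall fun ω => ?_)
      · exact (Complex.norm_exp_ofReal_mul_I _).le
      · simp [ENNReal.toReal_ofReal', mul_comm]
    · refine (Integrable.bdd_mul (c := 1) hX.neg.pos_part.ofReal (hmeas u).aestronglyMeasurable
        (Filter.Eventually.of_forall fun ω => ?_)).congr (Filter.Eventually.of_forall fun ω => ?_)
      · exact (Complex.norm_exp_ofReal_mul_I _).le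
      · simp [ENNReal.toReal_ofReal', mul_comm]
  let Φ : Ω → H → ℝ := fun ω h => W h ω
  have hΦ : Measurable Φ := measurable_pi_lambda _ fun h => hW.measurable h
  have hproj : μ.map Φ = ν.map Φ := by
    refine IsProjectiveLimit.unique (P := fun I => (μ.map Φ).map I.restrict) (fun I => rfl)
      (fun I => ?_)
    refine Measure.ext_of_charFunDual (funext fun L => ?_)
    have hr : Measurable (I.restrict : (H → ℝ) → (I → ℝ)) := Finset.measurable_restrict I
    -- By almost sure linearity, a functional of finitely many `W(i)` is a single `W(u)`.
    let u : H := ∑ i : I, L (Pi.single i 1) • (i : H)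
    have hu : ∀ᵐ ω ∂P, L (I.restrict (Φ ω)) = W u ω := by
      filter_upwards [hW.sum_ae_eq Finset.univ (fun i : I => L (Pi.single i 1)) (fun i : I => (i : H))]
        with ω hω
      rw [hω, ← L.sum_comp_single]
      refine Finset.sum_congr rfl fun i _ => ?_
      have : (Pi.single i ((I.restrict (Φ ω)) i) : I → ℝ) = W i ω • Pi.single i (1 : ℝ) := by
        rw [← Pi.single_smul]
        simp [Φ]
      simp only [ContinuousLinearMap.comp_apply, ContinuousLinearMap.single_apply]
      rw [this, map_smul, smul_eq_mul, mul_comm]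
    have key : ∀ ρ : Measure Ω, ρ ≪ P →
        charFunDual ((ρ.map Φ).map I.restrict) L = ∫ ω, Complex.exp (W u ω * Complex.I) ∂ρ := by
      intro ρ hρ
      rw [charFunDual_apply, Measure.map_map hr hΦ, integral_map (hr.comp hΦ).aemeasurable
        (by fun_prop)]
      refine integral_congr_ae ?_
      filter_upwards [hρ.ae_le hu] with ω hω
      simp only [Function.comp_apply, hω]
    rw [key _ (withDensity_absolutelyContinuous _ _), key _ (withDensity_absolutelyContinuous _ _),
      hexp]
  have hgen : mΩ = MeasurableSpace.comap Φ MeasurableSpace.pi := by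
    rw [MeasurableSpace.pi, MeasurableSpace.comap_iSup]
    conv_lhs => rw [hW.generates]
    refine iSup_congr fun h => ?_
    rw [MeasurableSpace.comap_comp]
    rfl
  have hμν : μ = ν := by
    ext A hA
    rw [hgen] at hA
    obtain ⟨B, hB, rfl⟩ := hA
    rw [← Measure.map_apply hΦ hB, ← Measure.map_apply hΦ hB, hproj]
  refine hX.ae_eq_of_forall_setIntegral_eq _ _ (integrable_zero _ _ _) fun A hA _ => ?_
  have h1 : μ A = ν A := by rw [hμν]
  rw [hμ, hν, withDensity_apply _ hA, withDensity_apply _ hA] at h1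
  rw [integral_eq_lintegral_pos_part_sub_lintegral_neg_part hX.integrableOn, h1]
  simp

end Totality

end WienerChaos

namespace WienerChaos

open scoped ENNReal

/-! ### Closability and the Malliavin derivative of double integrals -/

section Malliavin

variable {H : Type*} [NormedAddCommGroup H] [InnerProductSpace ℝ H]
  {Ω : Type*} [mΩ : MeasurableSpace Ω] {P : Measure Ω} {W : H → Ω → ℝ}

theorem hasTemperateGrowth_cos : Function.HasTemperateGrowth Real.cos :=
  ⟨Real.contDiff_cos, fun n => ⟨0, 1, fun x => by
    simpa [norm_iteratedFDeriv_eq_norm_iteratedDeriv] using Real.abs_iteratedDeriv_cos_le_one n x⟩⟩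

theorem hasTemperateGrowth_sin : Function.HasTemperateGrowth Real.sin :=
  ⟨Real.contDiff_sin, fun n => ⟨0, 1, fun x => by
    simpa [norm_iteratedFDeriv_eq_norm_iteratedDeriv] using Real.abs_iteratedDeriv_sin_le_one n x⟩⟩

theorem IsIsonormal.memLp_comp (hW : IsIsonormal W P) {k : ℝ → ℝ}
    (hk : Function.HasTemperateGrowth k) (u : H) (p : ℝ≥0∞) (hp : p ≠ ∞) :
    MemLp (fun ω => k (W u ω)) p P := by
  have := hW.gaussian.isProbabilityMeasure
  obtain ⟨n, C, h⟩ := hk.2 0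
  exact memLp_comp_of_norm_le (hW.memLp u) hk.1.continuous (fun x => by simpa using h x) p hp

theorem IsIsonormal.memLp_comp_deriv (hW : IsIsonormal W P) {k : ℝ → ℝ}
    (hk : Function.HasTemperateGrowth k) (u : H) (p : ℝ≥0∞) (hp : p ≠ ∞) :
    MemLp (fun ω => deriv k (W u ω)) p P := by
  have := hW.gaussian.isProbabilityMeasure
  obtain ⟨n, C, h⟩ := hk.2 1
  refine memLp_comp_of_norm_le (hW.memLp u) (hk.1.continuous_deriv (by simp))
    (fun x => ?_) p hp (C := C) (n := n)
  simpa [norm_iteratedFDeriv_eq_norm_iteratedDeriv] using h x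

/-- The duality between the Malliavin derivative and the divergence, tested against `k(W(u)) h`. -/
theorem IsIsonormal.integral_fderiv_mul (hW : IsIsonormal W P) {n : ℕ} {g : (Fin n → ℝ) → ℝ}
    (hg : Function.HasTemperateGrowth g) (φ : Fin n → H) {k : ℝ → ℝ}
    (hk : Function.HasTemperateGrowth k) (u h : H) :
    ∫ ω, fderiv ℝ g (fun i => W (φ i) ω) (fun i => inner ℝ (φ i) h) * k (W u ω) ∂P =
      ∫ ω, g (fun i => W (φ i) ω) * (k (W u ω) * W h ω - inner ℝ u h * deriv k (W u ω)) ∂P := by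
  have := hW.gaussian.isProbabilityMeasure
  -- The coordinate `none` carries `W u` and the others the `W (φ i)`, so that `g · k` is one
  -- cylindrical function to integrate by parts.
  let r : (Option (Fin n) → ℝ) →L[ℝ] (Fin n → ℝ) :=
    ContinuousLinearMap.pi fun i => ContinuousLinearMap.proj (some i)
  let s : (Option (Fin n) → ℝ) →L[ℝ] ℝ := ContinuousLinearMap.proj none
  have hK : Function.HasTemperateGrowth (fun x : Option (Fin n) → ℝ => g (r x) * k (s x)) :=
    (hg.comp r.hasTemperateGrowth).mul (hk.comp s.hasTemperateGrowth)
  have hd : ∀ x v : Option (Fin n) → ℝ, fderiv ℝ (fun x => g (r x) * k (s x)) x v =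
      fderiv ℝ g (r x) (r v) * k (s x) + g (r x) * (s v * deriv k (s x)) := by
    intro x v
    have h1 : HasFDerivAt (fun x => g (r x)) ((fderiv ℝ g (r x)).comp r) x :=
      ((hg.1.differentiable (by simp)) (r x)).hasFDerivAt.comp x r.hasFDerivAt
    have h2 : HasFDerivAt (fun x => k (s x)) (deriv k (s x) • s) x :=
      HasDerivAt.comp_hasFDerivAt (f := s) x
        ((hk.1.differentiable (by simp)) (s x)).hasDerivAt s.hasFDerivAt
    rw [(h1.fun_mul h2).fderiv]
    simp
    ring
  have hibp := hW.integral_mul (fun o : Option (Fin n) => o.elim u φ) h hK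
  simp only [hd] at hibp
  have hr : ∀ ω, r (fun o => W (o.elim u φ) ω) = fun i => W (φ i) ω := fun ω => rfl
  have hs : ∀ ω, s (fun o => W (o.elim u φ) ω) = W u ω := fun ω => rfl
  have hr' : r (fun o => inner ℝ (o.elim u φ) h) = fun i => inner ℝ (φ i) h := rfl
  have hs' : s (fun o => inner ℝ (o.elim u φ) h) = inner ℝ u h := rfl
  simp only [hr, hs, hr', hs'] at hibp
  obtain ⟨n0, C0, hC0⟩ := hg.2 0
  obtain ⟨n1, C1, hC1⟩ := hg.2 1
  have m0 : MemLp (fun ω => g (fun i => W (φ i) ω)) 2 P :=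
    memLp_comp_of_norm_le (hW.memLp_vector φ) hg.1.continuous (fun x => by simpa using hC0 x) 2
      (by simp)
  have m1 : MemLp (fun ω => fderiv ℝ g (fun i => W (φ i) ω)) 2 P :=
    memLp_comp_of_norm_le (hW.memLp_vector φ) (hg.1.continuous_fderiv (by simp))
      (fun x => by simpa [norm_iteratedFDeriv_one] using hC1 x) 2 (by simp)
  have m1' : MemLp (fun ω => fderiv ℝ g (fun i => W (φ i) ω) (fun i => inner ℝ (φ i) h)) 2 P :=
    (ContinuousLinearMap.apply ℝ ℝ (fun i => inner ℝ (φ i) h : Fin n → ℝ)).comp_memLp' m1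
  have i1 := m1'.integrable_mul (hW.memLp_comp hk u 2 (by simp))
  have i2 := m0.integrable_mul ((hW.memLp_comp_deriv hk u 2 (by simp)).const_mul (inner ℝ u h))
  have i3 := m0.integrable_mul
    (memLp_mul_of_forall (hW.memLp_comp hk u) (hW.memLp h) 2 (by simp))
  have e : ∀ ω, g (fun i => W (φ i) ω) * (k (W u ω) * W h ω - inner ℝ u h * deriv k (W u ω)) =
      g (fun i => W (φ i) ω) * (k (W u ω) * W h ω) -
        g (fun i => W (φ i) ω) * (inner ℝ u h * deriv k (W u ω)) := fun ω => by ring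
  simp only [e]
  simp only [mul_assoc] at hibp
  have hsub := integral_sub i3 i2
  have hadd := integral_add i1 i2
  simp only [Pi.mul_apply] at hsub hadd
  rw [hsub, hibp, hadd, add_sub_cancel_right]

/-- Both sides of the duality formula are inner products with fixed elements of `L²`, so the pairs
that satisfy it form a closed subspace, and the formula extends to the closure of the graph. -/
theorem integral_graph_closure (hW : IsIsonormal W P) {k : ℝ → ℝ}
    (hk : Function.HasTemperateGrowth k) (u h : H) {p : Lp ℝ 2 P × Lp H 2 P}
    (hp : p ∈ (Submodule.span ℝ (cylindricalGraph W P)).topologicalClosure) :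
    ∫ ω, inner ℝ (p.2 ω) h * k (W u ω) ∂P =
      ∫ ω, p.1 ω * (k (W u ω) * W h ω - inner ℝ u h * deriv k (W u ω)) ∂P := by
  have hm1 : MemLp (fun ω => k (W u ω) • h) 2 P :=
    ((ContinuousLinearMap.id ℝ ℝ).smulRight h).comp_memLp' (hW.memLp_comp hk u 2 (by simp))
  have hm2 : MemLp (fun ω => k (W u ω) * W h ω - inner ℝ u h * deriv k (W u ω)) 2 P :=
    (memLp_mul_of_forall (hW.memLp_comp hk u) (hW.memLp h) 2 (by simp)).sub
      ((hW.memLp_comp_deriv hk u 2 (by simp)).const_mul _)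
  set Z₁ := hm1.toLp
  set Z₂ := hm2.toLp
  have l1 : ∀ Y : Lp H 2 P, inner ℝ Y Z₁ = ∫ ω, inner ℝ (Y ω) h * k (W u ω) ∂P := fun Y => by
    rw [L2.inner_def]
    refine integral_congr_ae ?_
    filter_upwards [hm1.coeFn_toLp] with ω hω
    rw [hω, real_inner_smul_right, mul_comm]
  have l2 : ∀ X : Lp ℝ 2 P, inner ℝ X Z₂ =
      ∫ ω, X ω * (k (W u ω) * W h ω - inner ℝ u h * deriv k (W u ω)) ∂P := fun X =>
    inner_L2_eq_integral (Filter.EventuallyEq.refl _ X) hm2.coeFn_toLp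
  let K : Submodule ℝ (Lp ℝ 2 P × Lp H 2 P) :=
    { carrier := {p | inner ℝ p.2 Z₁ = inner ℝ p.1 Z₂}
      zero_mem' := by simp
      add_mem' := fun {a b} ha hb => by
        simp only [Set.mem_ofPred_eq, Prod.snd_add, Prod.fst_add, inner_add_left] at *
        rw [ha, hb]
      smul_mem' := fun c a ha => by
        simp only [Set.mem_ofPred_eq, Prod.smul_snd, Prod.smul_fst, real_inner_smul_left] at *
        rw [ha] }
  have hKc : IsClosed (K : Set (Lp ℝ 2 P × Lp H 2 P)) :=
    isClosed_eq (by fun_prop) (by fun_prop)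
  have hle : (Submodule.span ℝ (cylindricalGraph W P)).topologicalClosure ≤ K := by
    refine Submodule.topologicalClosure_minimal _ (Submodule.span_le.mpr ?_) hKc
    rintro ⟨X, Y⟩ ⟨n, g, φ, hg, hX, hY⟩
    change inner ℝ Y Z₁ = inner ℝ X Z₂
    rw [l1, l2]
    have e1 : ∫ ω, inner ℝ (Y ω) h * k (W u ω) ∂P =
        ∫ ω, fderiv ℝ g (fun i => W (φ i) ω) (fun i => inner ℝ (φ i) h) * k (W u ω) ∂P := by
      refine integral_congr_ae ?_
      filter_upwards [hY] with ω hω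
      simp only [hω, sum_inner, real_inner_smul_left]
      congr 1
      set L := fderiv ℝ g (fun j => W (φ j) ω)
      conv_rhs => rw [← L.sum_comp_single]
      refine Finset.sum_congr rfl fun i _ => ?_
      have : (Pi.single i (inner ℝ (φ i) h) : Fin n → ℝ) =
          (inner ℝ (φ i) h : ℝ) • Pi.single i (1 : ℝ) := by
        rw [← Pi.single_smul]; simp
      simp only [ContinuousLinearMap.comp_apply, ContinuousLinearMap.single_apply]
      rw [this, map_smul, smul_eq_mul, mul_comm]
    have e2 : ∫ ω, X ω * (k (W u ω) * W h ω - inner ℝ u h * deriv k (W u ω)) ∂P =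
        ∫ ω, g (fun i => W (φ i) ω) * (k (W u ω) * W h ω - inner ℝ u h * deriv k (W u ω)) ∂P := by
      refine integral_congr_ae ?_
      filter_upwards [hX] with ω hω
      simp only [hω]
    rw [e1, e2, hW.integral_fderiv_mul hg φ hk u h]
  have := hle hp
  rw [← l1, ← l2]
  exact this

/-- The Malliavin derivative on smooth cylindrical random variables is closable. -/
theorem malliavin_closable [TopologicalSpace.SeparableSpace H] (hW : IsIsonormal W P)
    (p : Lp ℝ 2 P × Lp H 2 P)
    (hp : p ∈ (Submodule.span ℝ (cylindricalGraph W P)).topologicalClosure) (h0 : p.1 = 0) :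
    p.2 = 0 := by
  have := hW.gaussian.isProbabilityMeasure
  have : SecondCountableTopology H := UniformSpace.secondCountable_of_separable H
  rw [Lp.eq_zero_iff_ae_eq_zero]
  -- When `p.1 = 0`, duality makes every `⟨h, p.2⟩` orthogonal to all `cos W(u)` and `sin W(u)`, and
  -- totality applies. Separability is used to pass from each `h` to the vector itself.
  refine ae_eq_zero_of_forall_inner (𝕜 := ℝ) fun h => ?_
  have hz : ∀ {k : ℝ → ℝ}, Function.HasTemperateGrowth k → ∀ u,
      ∫ ω, inner ℝ h (p.2 ω) * k (W u ω) ∂P = 0 := by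
    intro k hk u
    have := integral_graph_closure hW hk u h hp
    simp only [fun ω => real_inner_comm (p.2 ω) h]
    rw [this, integral_eq_zero_of_ae]
    rw [h0]
    exact Filter.Eventually.of_forall fun ω => by simp
  refine hW.ae_eq_zero_of_integral_trig ?_ (hz hasTemperateGrowth_cos) (hz hasTemperateGrowth_sin)
  exact ((innerSL ℝ h).comp_memLp' (Lp.memLp p.2)).integrable (by norm_num)

/-- Closability makes the closure of the graph single-valued, so any pair in it computes the
derivative. -/
theorem malliavinD_eq [TopologicalSpace.SeparableSpace H] (hW : IsIsonormal W P)
    {X : Lp ℝ 2 P} {Y : Lp H 2 P}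
    (h : (X, Y) ∈ (Submodule.span ℝ (cylindricalGraph W P)).topologicalClosure) :
    malliavinD W P X = Y := by
  set M := (Submodule.span ℝ (cylindricalGraph W P)).topologicalClosure with hM
  have hcl : ∀ (x : Lp ℝ 2 P × Lp H 2 P) (_ : x ∈ M) (_ : x.1 = 0), x.2 = 0 :=
    fun x hx hx0 => malliavin_closable hW x hx hx0
  have hX : X ∈ (malliavinOp W P).domain := by
    rw [malliavinOp, Submodule.toLinearPMap_domain]
    exact ⟨(X, Y), h, rfl⟩
  rw [malliavinD, dif_pos hX]
  have hmem : (X, malliavinOp W P ⟨X, hX⟩) ∈ M := Submodule.mem_graph_toLinearPMap hcl ⟨X, hX⟩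
  have := hcl _ (M.sub_mem hmem h) (by simp)
  exact sub_eq_zero.mp (by simpa using this)

theorem IsIsonormal.memLp_smul (hW : IsIsonormal W P) (u v : H) :
    MemLp (fun ω => W u ω • v) 2 P :=
  ((ContinuousLinearMap.id ℝ ℝ).smulRight v).comp_memLp' (hW.memLp u 2 (by simp))

/-- The bilinear map `(u, v) ↦ W(u) v` into the `H`-valued random variables. -/
noncomputable def vectorB (hW : IsIsonormal W P) : H →ₗ[ℝ] H →ₗ[ℝ] Lp H 2 P :=
  have hadd : ∀ u u', W (u + u') =ᵐ[P] fun ω => W u ω + W u' ω := fun u u' => by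
    simpa using hW.combination_ae_eq 1 1 u u'
  have hsmul : ∀ (c : ℝ) u, W (c • u) =ᵐ[P] fun ω => c * W u ω := fun c u => by
    simpa using hW.combination_ae_eq c 0 u 0
  LinearMap.mk₂ ℝ (fun u v => (hW.memLp_smul u v).toLp)
    (fun u u' v => by
      rw [← MemLp.toLp_add]
      refine MemLp.toLp_congr _ _ ?_
      filter_upwards [hadd u u'] with ω h
      rw [h, add_smul]
      rfl)
    (fun c u v => by
      rw [← MemLp.toLp_const_smul]
      refine MemLp.toLp_congr _ _ ?_
      filter_upwards [hsmul c u] with ω h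
      rw [h, mul_smul]
      rfl)
    (fun u v v' => by
      rw [← MemLp.toLp_add]
      refine MemLp.toLp_congr _ _ (Filter.Eventually.of_forall fun ω => ?_)
      exact smul_add _ _ _)
    (fun c u v => by
      rw [← MemLp.toLp_const_smul]
      refine MemLp.toLp_congr _ _ (Filter.Eventually.of_forall fun ω => ?_)
      exact smul_comm _ _ _)

theorem vectorB_ae_eq (hW : IsIsonormal W P) (u v : H) :
    vectorB hW u v =ᵐ[P] fun ω => W u ω • v :=
  (hW.memLp_smul u v).coeFn_toLp

theorem inner_vectorB (hW : IsIsonormal W P) (u v u' v' : H) :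
    inner ℝ (vectorB hW u v) (vectorB hW u' v') = inner ℝ u u' * inner ℝ v v' := by
  rw [L2.inner_def, ← hW.covariance, ← integral_mul_const]
  refine integral_congr_ae ?_
  filter_upwards [vectorB_ae_eq hW u v, vectorB_ae_eq hW u' v'] with ω h1 h2
  rw [h1, h2, real_inner_smul_left, real_inner_smul_right]
  ring

theorem norm_lift_vectorB (hW : IsIsonormal W P) (t : H ⊗[ℝ] H) :
    ‖TensorProduct.lift (vectorB hW) t‖ = ‖t‖ := by
  have h : ∀ s t : H ⊗[ℝ] H, inner ℝ (TensorProduct.lift (vectorB hW) s)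
      (TensorProduct.lift (vectorB hW) t) = inner ℝ s t := by
    intro s t
    induction s using TensorProduct.induction_on with
    | zero => simp
    | add s s' hs hs' => simp only [map_add, inner_add_left, hs, hs']
    | tmul u v =>
      induction t using TensorProduct.induction_on with
      | zero => simp
      | add s s' hs hs' => simp only [map_add, inner_add_right, hs, hs']
      | tmul u' v' => simp [inner_vectorB]
  rw [← sq_eq_sq₀ (norm_nonneg _) (norm_nonneg _), ← real_inner_self_eq_norm_sq, h]
  exact real_inner_self_eq_norm_sq t

variable [CompleteSpace H]

/-- The first Wiener integral with values in `H`: the map `u ⊗ v ↦ W(u) v`. -/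
noncomputable def vectorL (hW : IsIsonormal W P) : Tensor2 H →L[ℝ] Lp H 2 P :=
  tensor2Lift (vectorB hW)

theorem vectorL_tmul2 (hW : IsIsonormal W P) (u v : H) :
    vectorL hW (tmul2 u v) =ᵐ[P] fun ω => W u ω • v := by
  rw [vectorL, tensor2Lift_tmul2 _ 1 (fun t => by rw [norm_lift_vectorB, one_mul])]
  exact vectorB_ae_eq hW u v

/-- For elementary tensors, `D(W(u) W(v) - ⟨u, v⟩) = W(u) v + W(v) u`. The pair is linear and
continuous in `t` and the target is a closed subspace, so the general case follows by density. -/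
theorem wickL_mem_graph (hW : IsIsonormal W P) (t : Tensor2 H) :
    (wickL hW t, vectorL hW (t + swap2 t)) ∈
      (Submodule.span ℝ (cylindricalGraph W P)).topologicalClosure := by
  set M := (Submodule.span ℝ (cylindricalGraph W P)).topologicalClosure
  refine tensor2_induction (p := fun t => (wickL hW t, vectorL hW (t + swap2 t)) ∈ M)
    ((Submodule.isClosed_topologicalClosure _).preimage (by fun_prop)) (fun u v => ?_)
    (fun s t hs ht => ?_) t
  · refine Submodule.le_topologicalClosure _ (Submodule.subset_span
      ⟨2, fun x => x 0 * x 1 - inner ℝ u v, ![u, v], ?_, ?_, ?_⟩)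
    · have hp : ∀ i : Fin 2, Function.HasTemperateGrowth (fun x : Fin 2 → ℝ => x i) := fun i =>
        (ContinuousLinearMap.proj (R := ℝ) (φ := fun _ : Fin 2 => ℝ) i).hasTemperateGrowth
      exact ((hp 0).mul (hp 1)).sub (.const _)
    · filter_upwards [wickL_tmul2 hW u v] with ω hω
      simpa using hω
    · rw [map_add, swap2_tmul2]
      filter_upwards [Lp.coeFn_add (vectorL hW (tmul2 u v)) (vectorL hW (tmul2 v u)),
        vectorL_tmul2 hW u v, vectorL_tmul2 hW v u] with ω h1 h2 h3
      rw [h1, Pi.add_apply, h2, h3]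
      have hd : ∀ x y : Fin 2 → ℝ, fderiv ℝ (fun x : Fin 2 → ℝ => x 0 * x 1 - inner ℝ u v) x y =
          y 0 * x 1 + y 1 * x 0 := by
        intro x y
        have hp : ∀ i : Fin 2, HasFDerivAt (fun x : Fin 2 → ℝ => x i)
            (ContinuousLinearMap.proj (R := ℝ) (φ := fun _ : Fin 2 => ℝ) i) x := fun i =>
          (ContinuousLinearMap.proj (R := ℝ) (φ := fun _ : Fin 2 => ℝ) i).hasFDerivAt
        rw [(((hp 0).fun_mul (hp 1)).sub_const _).fderiv]
        simp
        ring
      simp [hd, Fin.sum_univ_two, add_comm]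
  · have e : (wickL hW (s + t), vectorL hW (s + t + swap2 (s + t))) =
        (wickL hW s, vectorL hW (s + swap2 s)) + (wickL hW t, vectorL hW (t + swap2 t)) := by
      simp only [Prod.mk_add_mk, map_add]
      congr 1
      abel
    rw [e]
    exact M.add_mem hs ht

theorem malliavinD_wickL [TopologicalSpace.SeparableSpace H] (hW : IsIsonormal W P)
    {f : Tensor2 H} (hf : f ∈ symTensor2 H) (c : ℝ) :
    malliavinD W P (c • wickL hW f) = (2 * c) • vectorL hW f := by
  have h := wickL_mem_graph hW (c • f)
  rw [map_smul swap2, swap2_eq_self hf, ← two_smul ℝ, map_smul, map_smul, map_smul, smul_smul] at h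
  exact malliavinD_eq hW h

/-- The product formula for the Malliavin derivatives of double integrals. -/
theorem inner_vectorL_ae_eq (hW : IsIsonormal W P) {ι : Type*} (e : HilbertBasis ι ℝ H)
    (s t : Tensor2 H) :
    (fun ω => inner ℝ (vectorL hW s ω) (vectorL hW t ω)) =ᵐ[P]
      fun ω => wickL hW (contr e s t) ω + inner ℝ s t := by
  have := hW.gaussian.isProbabilityMeasure
  have hint : Integrable (fun ω => wickL hW (contr e s t) ω + inner ℝ s t) P :=
    ((Lp.memLp (wickL hW (contr e s t))).integrable (by norm_num)).add (integrable_const _)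
  -- Almost everywhere equality is replaced by equality of the integrals over each measurable `A`.
  -- These are continuous in `s` and `t`, which reduces the claim to elementary tensors, where both
  -- sides are `W(u) W(u') ⟨v, v'⟩`.
  refine (L2.integrable_inner (𝕜 := ℝ) _ _).ae_eq_of_forall_setIntegral_eq _ _ hint
    fun A hA _ => ?_
  let R : Lp H 2 P →L[ℝ] Lp H 2 (P.restrict A) := LpToLpRestrictCLM Ω H ℝ P 2 A
  let R' : Lp ℝ 2 P →L[ℝ] Lp ℝ 2 (P.restrict A) := LpToLpRestrictCLM Ω ℝ ℝ P 2 A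
  have l1 : ∀ X Y : Lp H 2 P, ∫ ω in A, inner ℝ (X ω) (Y ω) ∂P = inner ℝ (R X) (R Y) := by
    intro X Y
    rw [L2.inner_def]
    refine integral_congr_ae ?_
    filter_upwards [LpToLpRestrictCLM_coeFn ℝ A X, LpToLpRestrictCLM_coeFn ℝ A Y] with ω h1 h2
    rw [h1, h2]
  have l2 : ∀ (X : Lp ℝ 2 P), ∫ ω in A, X ω ∂P = inner ℝ (R' X) (oneL2 (P.restrict A)) := by
    intro X
    rw [← integral_eq_inner_oneL2]
    refine integral_congr_ae ?_
    filter_upwards [LpToLpRestrictCLM_coeFn ℝ A X] with ω h1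
    rw [h1]
  have l3 : ∀ (X : Lp ℝ 2 P) (c : ℝ), ∫ ω in A, (X ω + c) ∂P =
      inner ℝ (R' X) (oneL2 (P.restrict A)) + P.real A * c := by
    intro X c
    rw [integral_add ((Lp.memLp X).integrable (by norm_num)).integrableOn
      (integrable_const _), l2]
    simp
  rw [l1, l3]
  refine tensor2_induction₂ (p := fun s t => inner ℝ (R (vectorL hW s)) (R (vectorL hW t)) =
    inner ℝ (R' (wickL hW (contr e s t))) (oneL2 (P.restrict A)) + P.real A * inner ℝ s t)
    (fun t => ?_) (fun s => ?_) (fun u v u' v' => ?_) (fun s s' t h h' => ?_)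
    (fun s t t' h h' => ?_) s t
  · have : Continuous fun s => contr e s t :=
      ((ContinuousLinearMap.apply ℝ (Tensor2 H) t).comp (contrL e)).continuous
    exact isClosed_eq (by fun_prop) (by fun_prop)
  · have : Continuous fun t => contr e s t := (contrL e s).continuous
    exact isClosed_eq (by fun_prop) (by fun_prop)
  · rw [← l1, ← l3, contr_tmul2, map_smul]
    refine integral_congr_ae (ae_restrict_of_ae ?_)
    filter_upwards [vectorL_tmul2 hW u v, vectorL_tmul2 hW u' v', wickL_tmul2 hW u u',
      Lp.coeFn_smul (inner ℝ v v' : ℝ) (wickL hW (tmul2 u u'))] with ω h1 h2 h3 h4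
    rw [h1, h2, h4, Pi.smul_apply, h3, inner_tmul2, real_inner_smul_left, real_inner_smul_right,
      smul_eq_mul]
    ring
  · have : contr e (s + s') t = contr e s t + contr e s' t := by
      simp only [← contrL_apply, map_add, add_apply]
    simp only [this, map_add, inner_add_left, h, h']
    ring
  · have : contr e s (t + t') = contr e s t + contr e s t' := by
      simp only [← contrL_apply, map_add]
    simp only [this, map_add, inner_add_right, inner_add_left, h, h']
    ring

end Malliavin

end WienerChaos

namespace WienerChaos

/-! ### The Gamma operators of a double integral -/

section Gamma

variable {H : Type*} [NormedAddCommGroup H] [InnerProductSpace ℝ H] [CompleteSpace H]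
  [TopologicalSpace.SeparableSpace H]
  {Ω : Type*} [mΩ : MeasurableSpace Ω] {P : Measure Ω} {W : H → Ω → ℝ}
  {ι : Type*} (e : HilbertBasis ι ℝ H)

/-- In the inductive step `-D L⁻¹` contributes `2 · (1/2) = 1` and `DF` a factor `2`, which explains
`2 ^ i`; the product formula adds one contraction. The constant need not be tracked, since `L⁻¹`
kills it. -/
theorem gammaOp_wickL (hW : IsIsonormal W P) {f : Tensor2 H} (hf : f ∈ symTensor2 H) (i : ℕ) :
    ∃ c : ℝ, gammaOp W P (wickL hW f) i =
      wickL hW ((2 : ℝ) ^ i • iterContr e f (i + 1)) + c • oneL2 P := by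
  have := hW.gaussian.isProbabilityMeasure
  induction i with
  | zero => exact ⟨0, by simp [gammaOp, iterContr]⟩
  | succ i ih =>
    obtain ⟨c, hc⟩ := ih
    set g := iterContr e f (i + 1) with hg
    have hgs : g ∈ symTensor2 H := iterContr_mem e hf _
    have hD1 : malliavinD W P (wickL hW f) = (2 : ℝ) • vectorL hW f := by
      simpa using malliavinD_wickL hW hf 1
    have hD2 : malliavinD W P (pseudoInv W P (gammaOp W P (wickL hW f) i)) =
        (-(2 : ℝ) ^ i) • vectorL hW g := by
      rw [hc, pseudoInv_wickL, map_smul, smul_smul, malliavinD_wickL hW hgs]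
      congr 1
      ring
    have hae : (fun ω => inner ℝ (malliavinD W P (wickL hW f) ω)
        (-(malliavinD W P (pseudoInv W P (gammaOp W P (wickL hW f) i)) ω))) =ᵐ[P]
        (wickL hW ((2 : ℝ) ^ (i + 1) • iterContr e f (i + 1 + 1)) +
          ((2 : ℝ) ^ (i + 1) * inner ℝ g f) • oneL2 P : Lp ℝ 2 P) := by
      rw [hD1, hD2, iterContr, ← hg, map_smul]
      filter_upwards [inner_vectorL_ae_eq hW e g f, Lp.coeFn_smul (2 : ℝ) (vectorL hW f),
        Lp.coeFn_smul (-(2 : ℝ) ^ i) (vectorL hW g),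
        Lp.coeFn_add ((2 : ℝ) ^ (i + 1) • wickL hW (contr e g f))
          (((2 : ℝ) ^ (i + 1) * inner ℝ g f) • oneL2 P),
        Lp.coeFn_smul ((2 : ℝ) ^ (i + 1)) (wickL hW (contr e g f)),
        Lp.coeFn_smul ((2 : ℝ) ^ (i + 1) * inner ℝ g f) (oneL2 P), oneL2_ae_eq (P := P)]
        with ω h1 h2 h3 h4 h5 h6 h7
      rw [h2, h3, h4, Pi.add_apply, h5, h6]
      simp only [Pi.smul_apply, h7, smul_eq_mul, real_inner_smul_left, inner_neg_right,
        real_inner_smul_right]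
      rw [real_inner_comm, h1]
      ring
    refine ⟨(2 : ℝ) ^ (i + 1) * inner ℝ g f, ?_⟩
    -- The inner product agrees almost everywhere with an element of `L²`, so `toL2` does not take
    -- its default value.
    rw [gammaOp, toL2_eq_iff ((memLp_congr_ae hae).mpr (Lp.memLp _))]
    exact hae

/-- Wick products have mean zero, so the unknown constant is the expectation and centering removes
it. -/
theorem wickL_iterContr_ae_eq (hW : IsIsonormal W P) {f : Tensor2 H} (hf : f ∈ symTensor2 H)
    (i : ℕ) : wickL hW (iterContr e f (i + 1)) =ᵐ[P] fun ω =>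
      1 / 2 ^ i * (gammaOp W P (wickL hW f) i ω - ∫ ω', gammaOp W P (wickL hW f) i ω' ∂P) := by
  have := hW.gaussian.isProbabilityMeasure
  obtain ⟨c, hc⟩ := gammaOp_wickL e hW hf i
  rw [map_smul] at hc
  have hae : gammaOp W P (wickL hW f) i =ᵐ[P]
      fun ω => 2 ^ i * wickL hW (iterContr e f (i + 1)) ω + c := by
    rw [hc]
    filter_upwards [Lp.coeFn_add ((2 : ℝ) ^ i • wickL hW (iterContr e f (i + 1))) (c • oneL2 P),
      Lp.coeFn_smul ((2 : ℝ) ^ i) (wickL hW (iterContr e f (i + 1))),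
      Lp.coeFn_smul c (oneL2 P), oneL2_ae_eq (P := P)] with ω h4 h5 h6 h7
    rw [h4, Pi.add_apply, h5, h6]
    simp only [Pi.smul_apply, h7, smul_eq_mul, mul_one]
  have hm : ∫ ω', gammaOp W P (wickL hW f) i ω' ∂P = c := by
    rw [integral_congr_ae hae, integral_add
      (((Lp.memLp (wickL hW (iterContr e f (i + 1)))).integrable (by norm_num)).const_mul _)
      (integrable_const _), integral_const_mul, integral_wickL]
    simp
  filter_upwards [hae] with ω hω
  rw [hm, hω, add_sub_cancel_right, ← mul_assoc, one_div, inv_mul_cancel₀ (by positivity), one_mul]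

theorem wickL_contrSum_ae_eq (hW : IsIsonormal W P) {f : Tensor2 H} (hf : f ∈ symTensor2 H)
    (p : Polynomial ℝ) : wickL hW (contrSum e p f) =ᵐ[P] gammaSum W P p (wickL hW f) := by
  rw [contrSum, map_sum]
  have h1 := Lp.coeFn_fun_finsetSum (Finset.Icc 1 p.natDegree)
    (fun r => wickL hW (taylorCoeff p r • iterContr e f r))
  have h2 : ∀ᵐ ω ∂P, ∀ r ∈ Finset.Icc 1 p.natDegree,
      wickL hW (taylorCoeff p r • iterContr e f r) ω = (taylorCoeff p r / 2 ^ (r - 1)) *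
        (gammaOp W P (wickL hW f) (r - 1) ω - ∫ ω', gammaOp W P (wickL hW f) (r - 1) ω' ∂P) := by
    rw [Filter.eventually_all_finset]
    intro r hr
    obtain ⟨i, rfl⟩ : ∃ i, r = i + 1 := ⟨r - 1, by simp at hr; omega⟩
    rw [map_smul]
    filter_upwards [wickL_iterContr_ae_eq e hW hf i,
      Lp.coeFn_smul (taylorCoeff p (i + 1)) (wickL hW (iterContr e f (i + 1)))] with ω h1 h2
    rw [h2, Pi.smul_apply, h1, smul_eq_mul, Nat.add_sub_cancel]
    ring
  filter_upwards [h1, h2] with ω h1 h2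
  rw [h1, gammaSum]
  exact Finset.sum_congr rfl h2

theorem integral_gammaSum_sq (hW : IsIsonormal W P) {f : Tensor2 H} (hf : f ∈ symTensor2 H)
    (p : Polynomial ℝ) :
    1 / 2 * ∫ ω, gammaSum W P p (wickL hW f) ω ^ 2 ∂P = ‖contrSum e p f‖ ^ 2 := by
  have h := wickL_contrSum_ae_eq e hW hf p
  have h2 := inner_L2_eq_integral h h
  simp only [← sq] at h2
  rw [← h2, real_inner_self_eq_norm_sq, norm_wickL hW (contrSum_mem e hf p), mul_pow,
    Real.sq_sqrt (by norm_num)]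
  ring

end Gamma

end WienerChaos

namespace WienerChaos

/-! ### Diagonalization and independence of the listing of eigenvalues -/

section Spectral

universe u

variable {H : Type*} [NormedAddCommGroup H] [InnerProductSpace ℝ H] [CompleteSpace H]

/-- Elementary tensors give operators of rank at most one, and compactness survives operator norm
limits, which `f ↦ A_f` respects. -/
theorem isCompactOperator_hsOp (f : Tensor2 H) : IsCompactOperator (hsOp f) := by
  refine tensor2_induction (p := fun f => IsCompactOperator (hsOp f))
    ((isClosed_setOfPred_isCompactOperator (σ₁₂ := RingHom.id ℝ) (M₁ := H) (M₂ := H)).preimage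
      (hsOpL H).continuous) (fun a b => ?_) (fun s t hs ht => ?_) f
  · have h1 : IsCompactOperator (ContinuousLinearMap.id ℝ ℝ) :=
      isCompactOperator_id_iff_locallyCompactSpace.mpr inferInstance
    have h2 := (h1.comp_clm (innerSL ℝ b)).clm_comp ((ContinuousLinearMap.id ℝ ℝ).smulRight a)
    have e : (hsOp (tmul2 a b) : H → H) = ((ContinuousLinearMap.id ℝ ℝ).smulRight a) ∘
        ((ContinuousLinearMap.id ℝ ℝ) ∘ (innerSL ℝ b)) := by
      funext g
      simp [hsOp_tmul2]
    change IsCompactOperator (hsOp (tmul2 a b) : H → H)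
    rw [e]
    exact h2
  · rw [hsOp_add]
    exact hs.add ht

/-- The operator of a symmetric kernel is diagonal in some Hilbert basis. -/
theorem exists_eigenbasis {H : Type u} [NormedAddCommGroup H] [InnerProductSpace ℝ H]
    [CompleteSpace H] {f : Tensor2 H} (hf : f ∈ symTensor2 H) :
    ∃ (J : Type u) (b : HilbertBasis J ℝ H) (lam : J → ℝ), ∀ j, hsOp f (b j) = lam j • b j := by
  set T := hsOp f with hT
  have hsa : IsSelfAdjoint T := mem_symTensor2_iff.mp hf
  have hsymm : (T : H →ₗ[ℝ] H).IsSymmetric :=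
    ContinuousLinearMap.isSelfAdjoint_iff_isSymmetric.mp hsa
  have hbot := ContinuousLinearMap.orthogonalComplement_iSup_eigenspaces_eq_bot
    (isCompactOperator_hsOp f) hsymm
  have hcl : ∀ c : ℝ, IsClosed (Module.End.eigenspace (T : H →ₗ[ℝ] H) c : Set H) := by
    intro c
    have : (Module.End.eigenspace (T : H →ₗ[ℝ] H) c : Set H) = {x | T x = c • x} := by
      ext x
      exact Module.End.mem_eigenspace_iff
    rw [this]
    exact isClosed_eq T.continuous (continuous_const_smul c)
  have : ∀ c : ℝ, CompleteSpace (Module.End.eigenspace (T : H →ₗ[ℝ] H) c) :=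
    fun c => (hcl c).completeSpace_coe
  -- By the spectral theorem the eigenspaces, including the kernel, are orthogonal with dense span.
  -- Hilbert bases of all of them are glued into one, indexed by pairs whose first entry is the
  -- eigenvalue.
  choose w b hb using fun c : ℝ =>
    exists_hilbertBasis ℝ (Module.End.eigenspace (T : H →ₗ[ℝ] H) c)
  have hon : Orthonormal ℝ (fun a : Σ c : ℝ, w c => ((b a.1 a.2 : _) : H)) :=
    hsymm.orthogonalFamily_eigenspaces.orthonormal_sigma_orthonormal (fun c => (b c).orthonormal)
  have hperp : (Submodule.span ℝ (Set.range
      (fun a : Σ c : ℝ, w c => ((b a.1 a.2 : _) : H))))ᗮ = ⊥ := by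
    rw [Submodule.eq_bot_iff]
    intro x hx
    rw [Submodule.mem_orthogonal] at hx
    have hx' : ∀ c (j : w c), inner ℝ ((b c j : _) : H) x = 0 := fun c j =>
      hx _ (Submodule.subset_span ⟨⟨c, j⟩, rfl⟩)
    have : x ∈ (⨆ c, Module.End.eigenspace (T : H →ₗ[ℝ] H) c)ᗮ := by
      rw [← Submodule.iInf_orthogonal, Submodule.mem_iInf]
      intro c
      rw [Submodule.mem_orthogonal]
      intro y hy
      have h1 := ((b c).hasSum_repr ⟨y, hy⟩).mapL
        ((innerSL ℝ x).comp (Module.End.eigenspace (T : H →ₗ[ℝ] H) c).subtypeL)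
      have h2 : ∀ j, ((innerSL ℝ x).comp (Module.End.eigenspace (T : H →ₗ[ℝ] H) c).subtypeL)
          ((b c).repr ⟨y, hy⟩ j • b c j) = 0 := fun j => by
        rw [map_smul]
        have : inner ℝ x ((b c j : _) : H) = 0 := by rw [real_inner_comm]; exact hx' c j
        simp [this]
      simp only [h2] at h1
      have h3 := h1.unique hasSum_zero
      rw [real_inner_comm]
      simpa using h3
    rw [hbot] at this
    simpa using this
  refine ⟨Σ c : ℝ, w c, HilbertBasis.mkOfOrthogonalEqBot hon hperp, fun a => a.1, fun a => ?_⟩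
  rw [HilbertBasis.coe_mkOfOrthogonalEqBot]
  exact Module.End.mem_eigenspace_iff.mp (b a.1 a.2).2

variable {f : Tensor2 H} {J : Type*} {b : HilbertBasis J ℝ H} {lam : J → ℝ}

theorem hasSum_sq_eigenvalues (hb : ∀ j, hsOp f (b j) = lam j • b j) :
    HasSum (fun j => lam j ^ 2) (‖f‖ ^ 2) := by
  convert hasSum_norm_sq_hsOp b f using 2 with j
  rw [hb, norm_smul, b.orthonormal.1 j, mul_one, Real.norm_eq_abs, sq_abs]

/-- The squares of the eigenvalues are summable, hence tend to zero along the cofinite filter. -/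
theorem finite_fiber_eigenvalues (hb : ∀ j, hsOp f (b j) = lam j • b j) {c : ℝ} (hc : c ≠ 0) :
    {j | lam j = c}.Finite := by
  have h := (hasSum_sq_eigenvalues hb).summable.tendsto_cofinite_zero
  have h2 := h.eventually (gt_mem_nhds (show (0 : ℝ) < c ^ 2 by positivity))
  rw [Filter.eventually_cofinite] at h2
  refine h2.subset fun j hj => ?_
  simp only [Set.mem_ofPred_eq] at hj
  simp [hj]

/-- By symmetry of the operator, an eigenvector for `c` is orthogonal to every `b j` with another
eigenvalue. So the `b j` with `lam j = c` span the eigenspace, and counting them gives its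
dimension. -/
theorem listsEigenvalues_eigenbasis (hb : ∀ j, hsOp f (b j) = lam j • b j)
    (hf : f ∈ symTensor2 H) : ListsEigenvalues f lam := by
  intro c hc
  have hfin := finite_fiber_eigenvalues hb hc
  have hsa : IsSelfAdjoint (hsOp f) := mem_symTensor2_iff.mp hf
  have hsymm : (hsOp f : H →ₗ[ℝ] H).IsSymmetric :=
    ContinuousLinearMap.isSelfAdjoint_iff_isSymmetric.mp hsa
  have hspan : Module.End.eigenspace (hsOp f : H →ₗ[ℝ] H) c =
      Submodule.span ℝ (b '' {j | lam j = c}) := by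
    refine le_antisymm (fun x hx => ?_) (Submodule.span_le.mpr ?_)
    · have hx' : hsOp f x = c • x := Module.End.mem_eigenspace_iff.mp hx
      have h0 : ∀ j, j ∉ hfin.toFinset → b.repr x j • b j = 0 := by
        intro j hj
        have hj' : lam j ≠ c := by simpa using hj
        have h1 : lam j * inner ℝ (b j) x = c * inner ℝ (b j) x := by
          rw [← real_inner_smul_left, ← hb, ← real_inner_smul_right, ← hx']
          exact hsymm (b j) x
        have h2 : (lam j - c) * inner ℝ (b j) x = 0 := by linarith
        rw [b.repr_apply_apply, (mul_eq_zero.mp h2).resolve_left (sub_ne_zero.mpr hj'), zero_smul]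
      rw [(b.hasSum_repr x).unique (hasSum_sum_of_ne_finset_zero h0)]
      refine Submodule.sum_mem _ fun j hj => Submodule.smul_mem _ _ (Submodule.subset_span ?_)
      exact ⟨j, by simpa using hj, rfl⟩
    · rintro _ ⟨j, hj, rfl⟩
      refine Module.End.mem_eigenspace_iff.mpr ?_
      change hsOp f (b j) = c • b j
      rw [hb, show lam j = c from hj]
  have hli : LinearIndepOn ℝ id (b '' {j | lam j = c}) :=
    (b.orthonormal.linearIndependent.linearIndepOn_id).mono (Set.image_subset_range _ _)
  have hinj : Function.Injective b := b.orthonormal.linearIndependent.injective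
  rw [hspan, rank_span_set hli, ← hinj.encard_image]
  rfl

/-- Sums over the eigenvalues do not depend on the way they are listed. -/
theorem hasSum_of_listsEigenvalues {φ : ℝ → ℝ} (hφ : φ 0 = 0) {S : ℝ}
    (hb : ∀ j, hsOp f (b j) = lam j • b j) (hf : f ∈ symTensor2 H)
    (hS : HasSum (fun j => φ (lam j)) S) {K : Type*} {a : K → ℝ} (ha : ListsEigenvalues f a) :
    HasSum (fun k => φ (a k)) S := by
  have hlam := listsEigenvalues_eigenbasis hb hf
  -- Over each nonzero `c` the two listings have fibres of the same cardinality. Finiteness turns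
  -- this into a bijection; these glue to a bijection between the nonzero entries, and the zeros
  -- contribute nothing since `φ 0 = 0`.
  have hfib : ∀ c : {c : ℝ // c ≠ 0},
      Nonempty ({x : {k // a k ≠ 0} // (⟨a x, x.2⟩ : {c : ℝ // c ≠ 0}) = c} ≃
        {x : {j // lam j ≠ 0} // (⟨lam x, x.2⟩ : {c : ℝ // c ≠ 0}) = c}) := by
    intro c
    have hcard : {k | a k = c}.encard = {j | lam j = c}.encard := by
      rw [ha c c.2, hlam c c.2]
    have hfin := finite_fiber_eigenvalues hb c.2
    have hfin' : {k | a k = c}.Finite := by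
      rw [← Set.encard_lt_top_iff, hcard]
      exact Set.encard_lt_top_iff.mpr hfin
    have : Finite {k | a k = c} := hfin'
    have : Finite {j | lam j = c} := hfin
    have hn : Nat.card {k | a k = c} = Nat.card {j | lam j = c} := by
      rw [Nat.card_coe_set_eq, Nat.card_coe_set_eq, Set.ncard, Set.ncard, hcard]
    obtain ⟨e⟩ := Finite.card_eq.mp hn
    let e1 : {x : {k // a k ≠ 0} // (⟨a x, x.2⟩ : {c : ℝ // c ≠ 0}) = c} ≃ {k | a k = c} :=
      { toFun := fun x => ⟨x.1.1, congrArg Subtype.val x.2⟩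
        invFun := fun x => ⟨⟨x.1, by rw [show a x.1 = c from x.2]; exact c.2⟩, Subtype.ext x.2⟩
        left_inv := fun x => rfl
        right_inv := fun x => rfl }
    let e2 : {x : {j // lam j ≠ 0} // (⟨lam x, x.2⟩ : {c : ℝ // c ≠ 0}) = c} ≃ {j | lam j = c} :=
      { toFun := fun x => ⟨x.1.1, congrArg Subtype.val x.2⟩
        invFun := fun x => ⟨⟨x.1, by rw [show lam x.1 = c from x.2]; exact c.2⟩, Subtype.ext x.2⟩
        left_inv := fun x => rfl
        right_inv := fun x => rfl }
    exact ⟨(e1.trans e).trans e2.symm⟩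
  let E : {k // a k ≠ 0} ≃ {j // lam j ≠ 0} :=
    Equiv.ofFiberEquiv (f := fun x : {k // a k ≠ 0} => (⟨a x, x.2⟩ : {c : ℝ // c ≠ 0}))
      (g := fun x : {j // lam j ≠ 0} => (⟨lam x, x.2⟩ : {c : ℝ // c ≠ 0}))
      fun c => (hfib c).some
  have hE : ∀ x, lam (E x) = a x := fun x =>
    congrArg Subtype.val (Equiv.ofFiberEquiv_map (fun c => (hfib c).some) x)
  have h1 : HasSum ((fun j => φ (lam j)) ∘ ((↑) : {j | lam j ≠ 0} → J)) S := by
    rw [hasSum_subtype_iff_of_support_subset]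
    · exact hS
    · intro j hj h0
      exact hj (by simp [h0, hφ])
  have h2 : HasSum ((fun k => φ (a k)) ∘ ((↑) : {k | a k ≠ 0} → K)) S := by
    have h3 := (Equiv.hasSum_iff E).mpr h1
    have e : (fun k => φ (a k)) ∘ ((↑) : {k | a k ≠ 0} → K) =
        ((fun j => φ (lam j)) ∘ ((↑) : {j | lam j ≠ 0} → J)) ∘ E :=
      funext fun x => congrArg φ (hE x).symm
    rw [e]
    exact h3
  rwa [hasSum_subtype_iff_of_support_subset] at h2
  intro j hj h0
  exact hj (by simp [h0, hφ])

end Spectral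

end WienerChaos

namespace WienerChaos

/-! ### The characteristic function of a centered Gaussian square -/

section GaussianSquare

/-- The logarithm `-is - log(1 - 2is)/2` of the characteristic function of `Z² - 1`, with `Z`
standard Gaussian. -/
noncomputable def logChar (s : ℝ) : ℂ :=
  (1 / 2) * (-Complex.log (1 - 2 * Complex.I * s) - 2 * Complex.I * s)

/-- A Gaussian integral with complex parameter `(1 - 2is)/2`. The result is kept as an exponential
so that the exponents can be summed over the eigenvalues without choosing branches. -/
theorem integral_gaussianReal_sq_sub_one (s : ℝ) :
    ∫ z, Complex.exp (((s * (z ^ 2 - 1) : ℝ) : ℂ) * Complex.I) ∂(gaussianReal 0 1) =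
      Complex.exp (logChar s) := by
  set w : ℂ := 1 - 2 * Complex.I * s with hw
  have hwre : w.re = 1 := by simp [hw]
  have hw0 : w ≠ 0 := fun h => by simp [h] at hwre
  set b : ℂ := w / 2 with hb
  have hbre : 0 < b.re := by simp [hb, hwre]
  rw [integral_gaussianReal_eq_integral_smul one_ne_zero]
  have e : ∀ z : ℝ, gaussianPDFReal 0 1 z • Complex.exp (((s * (z ^ 2 - 1) : ℝ) : ℂ) * Complex.I) =
      (((√(2 * Real.pi))⁻¹ : ℝ) * Complex.exp (-(Complex.I * s))) *
        Complex.exp (-b * (z : ℂ) ^ 2) := by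
    intro z
    rw [gaussianPDFReal_def, Complex.real_smul]
    simp only [NNReal.coe_one, mul_one, sub_zero, Complex.ofReal_mul, Complex.ofReal_exp]
    rw [mul_assoc, mul_assoc (((√(2 * Real.pi))⁻¹ : ℝ) : ℂ), ← Complex.exp_add, ← Complex.exp_add]
    congr 2
    rw [hb, hw]
    push_cast
    ring
  simp only [e]
  rw [integral_const_mul, integral_gaussian_complex hbre]
  have h2pi : (0 : ℝ) < 2 * Real.pi := by positivity
  have hq : (Real.pi / b : ℂ) = ((2 * Real.pi : ℝ) : ℂ) * w⁻¹ := by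
    rw [hb]
    push_cast
    field_simp
  have hq0 : (Real.pi / b : ℂ) ≠ 0 := by
    rw [hq]
    exact mul_ne_zero (by exact_mod_cast h2pi.ne') (inv_ne_zero hw0)
  -- Since `w` has real part `1`, it stays off the branch cut and the principal logarithm may be
  -- used.
  have harg : w.arg ≠ Real.pi := by
    intro h
    rw [Complex.arg_eq_pi_iff] at h
    linarith [h.1]
  have hlog : Complex.log (Real.pi / b : ℂ) = Real.log (2 * Real.pi) - Complex.log w := by
    rw [hq, Complex.log_ofReal_mul h2pi (inv_ne_zero hw0), Complex.log_inv _ harg]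
    ring
  rw [Complex.cpow_def_of_ne_zero hq0, hlog]
  have hsq : ((√(2 * Real.pi) : ℝ) : ℂ) = Complex.exp (Real.log (2 * Real.pi) * (1 / 2)) := by
    have : √(2 * Real.pi) = Real.exp (Real.log (2 * Real.pi) * (1 / 2)) := by
      rw [Real.sqrt_eq_rpow, Real.rpow_def_of_pos h2pi]
    rw [this]
    push_cast
    rfl
  rw [Complex.ofReal_inv, hsq, ← Complex.exp_neg, ← Complex.exp_add, ← Complex.exp_add, logChar,
    ← hw]
  congr 1
  ring

/-- The series of `-log(1 - z)` at `z = 2is`, from which the centering removes the linear term. -/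
theorem hasSum_logChar {s : ℝ} (hs : |2 * s| < 1) :
    HasSum (fun m : ℕ => (1 / 2 : ℂ) * ((2 * Complex.I * s) ^ (m + 2) / (m + 2 : ℕ)))
      (logChar s) := by
  have hz : ‖(2 * Complex.I * s : ℂ)‖ < 1 := by
    simpa [abs_mul] using hs
  have h := (hasSum_nat_add_iff' 2).mpr (Complex.hasSum_taylorSeries_neg_log hz)
  have h2 := h.mul_left (1 / 2 : ℂ)
  simpa [Finset.sum_range_succ, logChar] using h2

end GaussianSquare

/-! ### The characteristic function of a double integral -/

section CharFun

variable {H : Type*} [NormedAddCommGroup H] [InnerProductSpace ℝ H]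
  {Ω : Type*} [mΩ : MeasurableSpace Ω] {P : Measure Ω} {W : H → Ω → ℝ}

theorem charFun_map_eq_integral {X : Ω → ℝ} (hX : AEMeasurable X P) (t : ℝ) :
    charFun (P.map X) t = ∫ ω, Complex.exp ((t * X ω : ℝ) * Complex.I) ∂P := by
  rw [charFun_apply_real, integral_map hX (by fun_prop)]
  simp

/-- From `|e^{ix} - e^{iy}| ≤ |x - y|` and the bound of the `L¹` norm by the `L²` norm. It allows
passing from finite eigenvalue sums to the limit in `L²`. -/
theorem norm_charFun_map_sub_le [IsProbabilityMeasure P] (X Y : Lp ℝ 2 P) (t : ℝ) :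
    ‖charFun (P.map X) t - charFun (P.map Y) t‖ ≤ |t| * ‖X - Y‖ := by
  have hint : ∀ Z : Lp ℝ 2 P, Integrable (fun ω => Complex.exp ((t * Z ω : ℝ) * Complex.I)) P := by
    intro Z
    have hZ := Lp.aestronglyMeasurable Z
    refine Integrable.of_bound (C := 1) (by fun_prop) (Filter.Eventually.of_forall fun ω => ?_)
    exact (Complex.norm_exp_ofReal_mul_I _).le
  have hZint : Integrable (X - Y : Lp ℝ 2 P) P := (Lp.memLp (X - Y)).integrable (by norm_num)
  rw [charFun_map_eq_integral (Lp.aestronglyMeasurable X).aemeasurable,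
    charFun_map_eq_integral (Lp.aestronglyMeasurable Y).aemeasurable, ← integral_sub (hint X) (hint Y)]
  have hone : ‖oneL2 P‖ = 1 := by
    rw [← sq_eq_sq₀ (norm_nonneg _) zero_le_one, ← real_inner_self_eq_norm_sq,
      inner_L2_eq_integral oneL2_ae_eq oneL2_ae_eq]
    simp
  have habs : ∫ ω, |(X - Y : Lp ℝ 2 P) ω| ∂P ≤ ‖X - Y‖ := by
    have h1 : ∫ ω, |(X - Y : Lp ℝ 2 P) ω| ∂P = inner ℝ (|X - Y|) (oneL2 P) := by
      rw [← integral_eq_inner_oneL2]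
      refine integral_congr_ae ?_
      filter_upwards [Lp.coeFn_abs (X - Y)] with ω hω
      rw [hω]
    rw [h1]
    refine (real_inner_le_norm _ _).trans ?_
    rw [hone, mul_one, norm_abs_eq_norm]
  calc ‖∫ ω, (Complex.exp ((t * X ω : ℝ) * Complex.I) - Complex.exp ((t * Y ω : ℝ) * Complex.I)) ∂P‖
      ≤ ∫ ω, |t| * |(X - Y : Lp ℝ 2 P) ω| ∂P := by
        refine norm_integral_le_of_norm_le (hZint.abs.const_mul _) ?_
        filter_upwards [Lp.coeFn_sub X Y] with ω hω
        rw [hω, Pi.sub_apply, ← abs_mul]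
        have e : Complex.exp ((t * X ω : ℝ) * Complex.I) - Complex.exp ((t * Y ω : ℝ) * Complex.I) =
            Complex.exp ((t * Y ω : ℝ) * Complex.I) *
              (Complex.exp (Complex.I * (t * (X ω - Y ω) : ℝ)) - 1) := by
          rw [mul_sub, ← Complex.exp_add, mul_one]
          congr 2
          push_cast
          ring
        rw [e, norm_mul, Complex.norm_exp_ofReal_mul_I, one_mul]
        exact Real.norm_exp_I_mul_ofReal_sub_one_le
    _ ≤ |t| * ‖X - Y‖ := by
        rw [integral_const_mul]
        exact mul_le_mul_of_nonneg_left habs (abs_nonneg _)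

theorem continuous_charFun_map [IsProbabilityMeasure P] (t : ℝ) :
    Continuous (fun X : Lp ℝ 2 P => charFun (P.map X) t) := by
  refine (LipschitzWith.of_dist_le_mul (K := Real.nnabs t) fun X Y => ?_).continuous
  rw [dist_eq_norm, dist_eq_norm]
  simpa using norm_charFun_map_sub_le X Y t

theorem IsIsonormal.iIndepFun (hW : IsIsonormal W P) {J : Type*} {b : J → H}
    (hb : Orthonormal ℝ b) : iIndepFun (fun j => W (b j)) P := by
  have hg : IsGaussianProcess (fun (p : (_ : J) × Unit) ω => W (b p.1) ω) P :=
    hW.gaussian.comp_right (fun p : (_ : J) × Unit => b p.1)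
  have h := hg.iIndepFun_of_covariance_eq_zero (X := fun j (_ : Unit) => W (b j))
    (fun j _ => (hW.measurable _).aemeasurable)
    (fun i j hij _ _ => by rw [hW.covariance_eq]; exact hb.2 hij)
  exact h.comp (fun _ x => x ()) (fun _ => measurable_pi_apply ())

theorem charFun_wickL_finset (hW : IsIsonormal W P) {J : Type*} {b : J → H}
    (hb : Orthonormal ℝ b) (lam : J → ℝ) (S : Finset J) (t : ℝ) :
    charFun (P.map (wickL hW (∑ j ∈ S, lam j • tmul2 (b j) (b j)))) t =
      Complex.exp (∑ j ∈ S, logChar (t * lam j)) := by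
  have hae : wickL hW (∑ j ∈ S, lam j • tmul2 (b j) (b j)) =ᵐ[P]
      fun ω => ∑ j ∈ S, lam j * (W (b j) ω ^ 2 - 1) := by
    rw [map_sum]
    have h2 : ∀ᵐ ω ∂P, ∀ j ∈ S, wickL hW (lam j • tmul2 (b j) (b j)) ω =
        lam j * (W (b j) ω ^ 2 - 1) := by
      rw [Filter.eventually_all_finset]
      intro j _
      rw [map_smul]
      filter_upwards [wickL_tmul2 hW (b j) (b j),
        Lp.coeFn_smul (lam j) (wickL hW (tmul2 (b j) (b j)))] with ω h1 h2
      rw [h2, Pi.smul_apply, h1, real_inner_self_eq_norm_sq, hb.1 j, smul_eq_mul]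
      ring
    filter_upwards [Lp.coeFn_fun_finsetSum S (fun j => wickL hW (lam j • tmul2 (b j) (b j))), h2]
      with ω h1 h2
    rw [h1]
    exact Finset.sum_congr rfl h2
  have hm : ∀ j, Measurable (fun ω => lam j * (W (b j) ω ^ 2 - 1)) := fun j => by
    have := hW.measurable (b j)
    fun_prop
  have hind : iIndepFun (fun j ω => lam j * (W (b j) ω ^ 2 - 1)) P :=
    (hW.iIndepFun hb).comp (fun j x => lam j * (x ^ 2 - 1)) (fun j => by fun_prop)
  rw [Measure.map_congr hae,
    (hind.restrict S).charFun_map_fun_finsetSum_eq_prod (fun j _ => (hm j).aemeasurable),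
    Finset.prod_apply, Complex.exp_sum]
  refine Finset.prod_congr rfl fun j _ => ?_
  rw [charFun_map_eq_integral (hm j).aemeasurable, ← integral_gaussianReal_sq_sub_one,
    ← hW.map_eq (hb.1 j), integral_map (hW.measurable _).aemeasurable (by fun_prop)]
  simp only [mul_assoc]

variable [CompleteSpace H] {f : Tensor2 H} {J : Type*} {b : HilbertBasis J ℝ H} {lam : J → ℝ}

/-- In `tensorBasis b` the coefficients of `f` are `lam j ⟨b j, b i⟩`, so only the diagonal remains.
-/
theorem hasSum_eigen_expansion (hb : ∀ j, hsOp f (b j) = lam j • b j) :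
    HasSum (fun j => lam j • tmul2 (b j) (b j)) f := by
  classical
  have h := (tensorBasis b).hasSum_repr f
  have hinj : Function.Injective (fun j : J => (j, j)) := fun i j h => (Prod.ext_iff.mp h).1
  have hval : ∀ p : J × J, (tensorBasis b).repr f p = lam p.2 * inner ℝ (b p.2) (b p.1) := by
    intro p
    rw [(tensorBasis b).repr_apply_apply, tensorBasis_apply, real_inner_comm, ← inner_hsOp, hb,
      real_inner_smul_left]
  rw [← hinj.hasSum_iff] at h
  · convert h using 2 with j
    simp only [Function.comp, hval, tensorBasis_apply]
    rw [real_inner_self_eq_norm_sq, b.orthonormal.1 j]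
    simp
  · rintro ⟨i, j⟩ hij
    have : j ≠ i := fun h => hij ⟨i, by simp [h]⟩
    rw [hval, b.orthonormal.2 this, mul_zero, zero_smul]

theorem charFun_wickL (hW : IsIsonormal W P) (hb : ∀ j, hsOp f (b j) = lam j • b j) {t : ℝ} {L : ℂ}
    (hL : HasSum (fun j => logChar (t * lam j)) L) :
    charFun (P.map (wickL hW f)) t = Complex.exp L := by
  have := hW.gaussian.isProbabilityMeasure
  have h1 : Filter.Tendsto (fun S : Finset J =>
      charFun (P.map (wickL hW (∑ j ∈ S, lam j • tmul2 (b j) (b j)))) t) Filter.atTop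
      (nhds (charFun (P.map (wickL hW f)) t)) :=
    (((continuous_charFun_map t).comp (wickL hW).continuous).tendsto f).comp
      (hasSum_eigen_expansion hb)
  simp only [charFun_wickL_finset hW b.orthonormal] at h1
  exact tendsto_nhds_unique h1 ((Complex.continuous_exp.tendsto L).comp hL)

end CharFun

end WienerChaos

namespace WienerChaos

/-! ### Cumulants as power sums of eigenvalues -/

section Cumulants

variable {H : Type*} [NormedAddCommGroup H] [InnerProductSpace ℝ H] [CompleteSpace H]
  {Ω : Type*} [mΩ : MeasurableSpace Ω] {P : Measure Ω} {W : H → Ω → ℝ}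
  {f : Tensor2 H} {J : Type*} {b : HilbertBasis J ℝ H} {lam : J → ℝ}

theorem abs_eigenvalue_le (hb : ∀ j, hsOp f (b j) = lam j • b j) (j : J) : |lam j| ≤ ‖f‖ := by
  have h := (hasSum_sq_eigenvalues hb).summable.le_tsum j (fun i _ => sq_nonneg (lam i))
  rw [(hasSum_sq_eigenvalues hb).tsum_eq] at h
  exact abs_le_of_sq_le_sq h (norm_nonneg _)

theorem summable_pow_eigenvalues (hb : ∀ j, hsOp f (b j) = lam j • b j) (m : ℕ) :
    Summable (fun j => lam j ^ (m + 2)) := by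
  refine Summable.of_norm_bounded ((hasSum_sq_eigenvalues hb).summable.mul_left (‖f‖ ^ m))
    fun j => ?_
  rw [norm_pow, pow_add, Real.norm_eq_abs, sq_abs]
  exact mul_le_mul_of_nonneg_right (pow_le_pow_left₀ (abs_nonneg _) (abs_eigenvalue_le hb j) m)
    (sq_nonneg _)

/-- The coefficients of the power series of the logarithm of the characteristic function. -/
noncomputable def logCharCoeff (lam : J → ℝ) (n : ℕ) : ℂ :=
  if n < 2 then 0 else (1 / 2) * ((2 * Complex.I) ^ n / n) * ((∑' j, lam j ^ n : ℝ) : ℂ)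

/-- The terms of the double series for the logarithm of the characteristic function. -/
noncomputable def logCharTerm (x : ℝ) (m : ℕ) : ℂ :=
  (1 / 2 : ℂ) * ((2 * Complex.I * x) ^ (m + 2) / (m + 2 : ℕ))

/-- The bound separates the variables: at `x = t * lam j` it is a term of the summable `t² lam j²`
times a term of a geometric series. -/
theorem norm_logCharTerm_le {x : ℝ} (hx : |2 * x| ≤ 1 / 2) (m : ℕ) :
    ‖logCharTerm x m‖ ≤ x ^ 2 * (1 / 2) ^ m := by
  have h1 : ‖(2 * Complex.I * x : ℂ)‖ = |2 * x| := by
    simp [abs_mul]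
  have h2 : |2 * x| ^ m ≤ (1 / 2) ^ m := pow_le_pow_left₀ (abs_nonneg _) hx m
  have h3 : |2 * x| ^ 2 = 4 * x ^ 2 := by rw [sq_abs]; ring
  have h4 : (2 : ℝ) ≤ ((m + 2 : ℕ) : ℝ) := by push_cast; linarith [Nat.cast_nonneg (α := ℝ) m]
  have h5 : ‖(1 / 2 : ℂ)‖ = 1 / 2 := by norm_num
  rw [logCharTerm, norm_mul, h5, norm_div, norm_pow, h1, pow_add, h3, Complex.norm_natCast]
  have h6 : |2 * x| ^ m * (4 * x ^ 2) ≤ (1 / 2) ^ m * (4 * x ^ 2) :=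
    mul_le_mul_of_nonneg_right h2 (by positivity)
  have h7 : |2 * x| ^ m * (4 * x ^ 2) / ((m + 2 : ℕ) : ℝ) ≤ (1 / 2) ^ m * (4 * x ^ 2) / 2 :=
    div_le_div₀ (by positivity) h6 (by norm_num) h4
  linarith

theorem hasSum_logCharTerm (hb : ∀ j, hsOp f (b j) = lam j • b j) (t : ℝ) (m : ℕ) :
    HasSum (fun j => logCharTerm (t * lam j) m) (t ^ (m + 2) • logCharCoeff lam (m + 2)) := by
  have h2 : HasSum (fun j => ((lam j ^ (m + 2) : ℝ) : ℂ))
      ((∑' j, lam j ^ (m + 2) : ℝ) : ℂ) :=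
    Complex.hasSum_ofReal.mpr (summable_pow_eigenvalues hb m).hasSum
  have h3 := h2.mul_left ((t : ℂ) ^ (m + 2) *
    ((1 / 2 : ℂ) * ((2 * Complex.I) ^ (m + 2) / (m + 2 : ℕ))))
  have e1 : (fun j => (t : ℂ) ^ (m + 2) * ((1 / 2 : ℂ) * ((2 * Complex.I) ^ (m + 2) /
      (m + 2 : ℕ))) * ((lam j ^ (m + 2) : ℝ) : ℂ)) = fun j => logCharTerm (t * lam j) m := by
    funext j
    rw [logCharTerm, Complex.ofReal_mul, Complex.ofReal_pow]
    ring
  have e2 : t ^ (m + 2) • logCharCoeff lam (m + 2) = (t : ℂ) ^ (m + 2) * ((1 / 2 : ℂ) *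
      ((2 * Complex.I) ^ (m + 2) / (m + 2 : ℕ))) * ((∑' j, lam j ^ (m + 2) : ℝ) : ℂ) := by
    rw [logCharCoeff, if_neg (by omega), Complex.real_smul, Complex.ofReal_pow]
    ring
  rw [e2, ← e1]
  exact h3

/-- For small `t` the double series over eigenvalues and powers converges absolutely. Summed by rows
it gives the exponent `L` of the characteristic function, summed by columns the power series in `t`.
-/
theorem hasSum_log_charFun_wickL (hW : IsIsonormal W P) (hb : ∀ j, hsOp f (b j) = lam j • b j)
    {t : ℝ} (ht : |t| * (4 * (‖f‖ + 1)) ≤ 1) :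
    HasSum (fun n : ℕ => t ^ n • logCharCoeff lam n)
      (Complex.log (charFun (P.map (wickL hW f)) t)) := by
  have hsmall : ∀ j, |2 * (t * lam j)| ≤ 1 / 2 := by
    intro j
    have h1 := abs_eigenvalue_le hb j
    have h2 : |t| * |lam j| ≤ |t| * (‖f‖ + 1) :=
      mul_le_mul_of_nonneg_left (by linarith) (abs_nonneg t)
    rw [abs_mul, abs_mul, abs_two]
    linarith
  have hnorm : ∀ p : J × ℕ, ‖logCharTerm (t * lam p.1) p.2‖ ≤
      (t ^ 2 * lam p.1 ^ 2) * (1 / 2) ^ p.2 := fun p => by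
    rw [← mul_pow]
    exact norm_logCharTerm_le (hsmall p.1) p.2
  have hsq := (hasSum_sq_eigenvalues hb).mul_left (t ^ 2)
  have hgeo : HasSum (fun m : ℕ => (1 / 2 : ℝ) ^ m) 2 := hasSum_geometric_two
  have hbound : HasSum (fun p : J × ℕ => (t ^ 2 * lam p.1 ^ 2) * (1 / 2 : ℝ) ^ p.2)
      (t ^ 2 * ‖f‖ ^ 2 * 2) :=
    hsq.mul hgeo (hsq.summable.mul_of_nonneg hgeo.summable (fun j => by positivity)
      (fun m => by positivity))
  obtain ⟨L, hTL⟩ : Summable fun p : J × ℕ => logCharTerm (t * lam p.1) p.2 :=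
    Summable.of_norm_bounded hbound.summable hnorm
  have hlog : ∀ j, HasSum (fun m => logCharTerm (t * lam j) m) (logChar (t * lam j)) := fun j => by
    have h : |2 * (t * lam j)| < 1 := lt_of_le_of_lt (hsmall j) (by norm_num)
    unfold logCharTerm
    exact hasSum_logChar h
  have hrow : HasSum (fun j => logChar (t * lam j)) L := hTL.prod_fiberwise hlog
  have hcol : HasSum (fun m : ℕ => t ^ (m + 2) • logCharCoeff lam (m + 2)) L := by
    have h1 : HasSum (fun p : ℕ × J => logCharTerm (t * lam p.2) p.1) L :=
      (Equiv.prodComm ℕ J).hasSum_iff.mpr hTL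
    exact h1.prod_fiberwise (hasSum_logCharTerm hb t)
  -- As `|t| ‖f‖ ≤ 1/4`, the dominating sum `2 t² ‖f‖²` is at most `1/8`. So the imaginary part of
  -- `L` lies within `(-π, π]`, and the principal logarithm of `exp L` is `L`.
  have hLnorm : ‖L‖ ≤ 1 / 8 := by
    rw [← hTL.tsum_eq]
    refine (tsum_of_norm_bounded hbound hnorm).trans ?_
    have h1 : |t| * ‖f‖ ≤ 1 / 4 := by
      have := mul_le_mul_of_nonneg_left (show ‖f‖ ≤ ‖f‖ + 1 by linarith) (abs_nonneg t)
      linarith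
    have h2 : (|t| * ‖f‖) ^ 2 ≤ (1 / 4) ^ 2 := pow_le_pow_left₀ (by positivity) h1 2
    rw [mul_pow, sq_abs] at h2
    linarith
  rw [charFun_wickL hW hb hrow, Complex.log_exp]
  · rw [← hasSum_nat_add_iff' 2]
    have h0 : ∑ i ∈ Finset.range 2, t ^ i • logCharCoeff lam i = 0 :=
      Finset.sum_eq_zero fun i hi => by
        rw [logCharCoeff, if_pos (Finset.mem_range.mp hi), smul_zero]
    rw [h0, sub_zero]
    exact hcol
  · have := (abs_le.mp ((Complex.abs_im_le_norm L).trans hLnorm)).1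
    linarith [Real.pi_gt_three]
  · have := (abs_le.mp ((Complex.abs_im_le_norm L).trans hLnorm)).2
    linarith [Real.pi_gt_three]

/-- A power series expansion determines the iterated derivatives at the origin. -/
theorem iteratedDeriv_of_hasSum {g : ℝ → ℂ} {c : ℕ → ℂ}
    (h : ∀ᶠ t in nhds (0 : ℝ), HasSum (fun n : ℕ => t ^ n • c n) (g t)) (n : ℕ) :
    iteratedDeriv n g 0 = (n.factorial : ℂ) * c n := by
  let p : FormalMultilinearSeries ℝ ℝ ℂ := fun n => ContinuousMultilinearMap.mkPiRing ℝ (Fin n) (c n)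
  have hp : ∀ n, p.coeff n = c n := fun n => by
    simp [p, FormalMultilinearSeries.coeff, ContinuousMultilinearMap.mkPiRing_apply]
  have hfp : HasFPowerSeriesAt g p 0 := by
    rw [hasFPowerSeriesAt_iff']
    filter_upwards [h] with t ht
    simpa [hp] using ht
  obtain ⟨r, hr⟩ := hfp
  rw [iteratedDeriv_eq_iteratedFDeriv, ← hr.factorial_smul 1 n]
  have : p n (fun _ => 1) = c n := hp n
  rw [this]
  simp

/-- The cumulants of a double integral are the power sums of the eigenvalues of its kernel. -/
theorem cumulant_wickL (hW : IsIsonormal W P) (hb : ∀ j, hsOp f (b j) = lam j • b j) (m : ℕ) :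
    cumulant P (wickL hW f) (m + 2) = 2 ^ (m + 1) * ((m + 1).factorial : ℝ) *
      ∑' j, lam j ^ (m + 2) := by
  have hev : ∀ᶠ t in nhds (0 : ℝ), HasSum (fun n : ℕ => t ^ n • logCharCoeff lam n)
      (Complex.log (charFun (P.map (wickL hW f)) t)) := by
    have hc : Continuous fun t : ℝ => |t| * (4 * (‖f‖ + 1)) := by fun_prop
    have := (hc.tendsto 0).eventually (Iic_mem_nhds (show |(0 : ℝ)| * (4 * (‖f‖ + 1)) < 1 by simp))
    filter_upwards [this] with t ht
    exact hasSum_log_charFun_wickL hW hb ht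
  rw [cumulant, iteratedDeriv_of_hasSum hev, logCharCoeff, if_neg (by omega)]
  -- The powers of `i` cancel. The remaining constants are `2^(m+2) / 2` and `(m+2)! / (m+2) =
  -- (m+1)!`.
  have hI : (-Complex.I) ^ (m + 2) * (2 * Complex.I) ^ (m + 2) = 2 ^ (m + 2) := by
    rw [← mul_pow]
    congr 1
    linear_combination -2 * Complex.I_mul_I
  have hne : ((m + 2 : ℕ) : ℂ) ≠ 0 := by exact_mod_cast (by omega : m + 2 ≠ 0)
  have e : (-Complex.I) ^ (m + 2) * (((m + 2).factorial : ℂ) *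
      (1 / 2 * ((2 * Complex.I) ^ (m + 2) / (m + 2 : ℕ)) * ((∑' j, lam j ^ (m + 2) : ℝ) : ℂ))) =
      ((2 ^ (m + 1) * ((m + 1).factorial : ℝ) * ∑' j, lam j ^ (m + 2) : ℝ) : ℂ) := by
    rw [Nat.factorial_succ]
    calc _ = ((-Complex.I) ^ (m + 2) * (2 * Complex.I) ^ (m + 2)) * (1 / 2) *
          ((m + 1).factorial : ℂ) * (((m + 2 : ℕ) : ℂ) / ((m + 2 : ℕ) : ℂ)) *
          ((∑' j, lam j ^ (m + 2) : ℝ) : ℂ) := by push_cast; ring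
      _ = _ := by
        rw [hI, div_self hne]
        push_cast
        ring
  rw [e, Complex.ofReal_re]

/-- Each cumulant is replaced by its power sum. The coefficients of order `0` and `1` must vanish:
the cumulant sum starts at `2`, and for a Hilbert-Schmidt operator the sum of the eigenvalues need
not converge. -/
theorem hasSum_cumulantSum (hW : IsIsonormal W P) (hb : ∀ j, hsOp f (b j) = lam j • b j)
    {Q : Polynomial ℝ} (h0 : Q.coeff 0 = 0) (h1 : Q.coeff 1 = 0) :
    HasSum (fun j => Q.eval (lam j)) (cumulantSum P Q (wickL hW f)) := by
  have key : ∀ r ∈ Finset.Icc 2 Q.natDegree, HasSum (fun j => Q.coeff r * lam j ^ r)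
      (taylorCoeff Q r * (cumulant P (wickL hW f) r / (2 ^ (r - 1) * ((r - 1).factorial : ℝ)))) := by
    intro r hr
    obtain ⟨m, rfl⟩ : ∃ m, r = m + 2 := ⟨r - 2, by simp at hr; omega⟩
    rw [cumulant_wickL hW hb, taylorCoeff_eq_coeff, show m + 2 - 1 = m + 1 by omega,
      mul_div_cancel_left₀ _ (by positivity)]
    exact (summable_pow_eigenvalues hb m).hasSum.mul_left _
  have h := hasSum_sum key
  rw [cumulantSum]
  convert h using 2 with j
  rw [Polynomial.eval_eq_sum_range]
  symm
  refine Finset.sum_subset_zero_on_sdiff (fun r hr => ?_) (fun r hr => ?_) (fun _ _ => rfl)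
  · simp at hr ⊢
    omega
  · have : r = 0 ∨ r = 1 := by
      simp at hr
      omega
    rcases this with rfl | rfl
    · simp [h0]
    · simp [h1]

end Cumulants

/-! ### The polynomials `P` and `Q`, and the main theorem -/

section Main

theorem polyP_coeff_zero {k : ℕ} (α : Fin k → ℝ) : (polyP α).coeff 0 = 0 := by
  simp [polyP]

theorem polyQ_coeff_zero {k : ℕ} (α : Fin k → ℝ) : (polyQ α).coeff 0 = 0 := by
  simp [polyQ, sq, Polynomial.mul_coeff_zero, polyP_coeff_zero]

theorem polyQ_coeff_one {k : ℕ} (α : Fin k → ℝ) : (polyQ α).coeff 1 = 0 := by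
  simp [polyQ, sq, Polynomial.mul_coeff_one, polyP_coeff_zero]

theorem polyQ_eval_zero {k : ℕ} (α : Fin k → ℝ) : (polyQ α).eval 0 = 0 := by
  rw [← Polynomial.coeff_zero_eq_eval_zero, polyQ_coeff_zero]

theorem polyQ_eval_root {k : ℕ} (α : Fin k → ℝ) (i : Fin k) : (polyQ α).eval (α i) = 0 := by
  have : ∏ j, (α i - α j) = 0 := Finset.prod_eq_zero (Finset.mem_univ i) (sub_self _)
  simp [polyQ, polyP, Polynomial.eval_prod, this]

end Main

end WienerChaos

theorem mainTheorem2
    {H : Type*} [NormedAddCommGroup H] [InnerProductSpace ℝ H] [CompleteSpace H]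
    [TopologicalSpace.SeparableSpace H]
    {ι : Type*} (e : HilbertBasis ι ℝ H)
    {Ω : Type*} [MeasurableSpace Ω] (P : Measure Ω) [IsProbabilityMeasure P]
    (W : H → Ω → ℝ) (hW : IsIsonormal W P)
    -- the target kernel: `α` lists its nonzero eigenvalues, which are pairwise distinct
    (fInf : symTensor2 H) (k : ℕ) (α : Fin k → ℝ)
    (hα : ListsEigenvalues (fInf : Tensor2 H) α)
    (hα_ne : ∀ i, α i ≠ 0) (hα_inj : Function.Injective α) :
    (∀ f : symTensor2 H,
      (∀ a : ℕ → ℝ, ListsEigenvalues (f : Tensor2 H) a →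
        HasSum (fun j => (polyQ α).eval (a j))
          (cumulantSum P (polyQ α) (doubleIntegral W P f))) ∧
      cumulantSum P (polyQ α) (doubleIntegral W P f) =
        ‖contrSum e (polyP α) (f : Tensor2 H)‖ ^ 2 ∧
      cumulantSum P (polyQ α) (doubleIntegral W P f) =
        1 / 2 * ∫ ω, gammaSum W P (polyP α) (doubleIntegral W P f) ω ^ 2 ∂P ∧
      ∀ r : ℕ, 1 ≤ r → ∃ hr : iterContr e (f : Tensor2 H) r ∈ symTensor2 H,
        doubleIntegral W P ⟨iterContr e (f : Tensor2 H) r, hr⟩ =ᵐ[P] fun ω =>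
          1 / 2 ^ (r - 1) * (gammaOp W P (doubleIntegral W P f) (r - 1) ω
            - ∫ ω', gammaOp W P (doubleIntegral W P f) (r - 1) ω' ∂P)) ∧
    cumulantSum P (polyQ α) (doubleIntegral W P fInf) = 0 ∧
    ∑ i, (polyQ α).eval (α i) = 0 ∧
    ‖contrSum e (polyP α) (fInf : Tensor2 H)‖ ^ 2 = 0 ∧
    1 / 2 * ∫ ω, gammaSum W P (polyP α) (doubleIntegral W P fInf) ω ^ 2 ∂P = 0 := by
  -- The index type is arbitrary so as to cover both sequences indexed by `ℕ` and the list `α`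
  -- indexed by `Fin k`.
  have hsum : ∀ (f : symTensor2 H) {K : Type} {a : K → ℝ}, ListsEigenvalues (f : Tensor2 H) a →
      HasSum (fun j => (polyQ α).eval (a j)) (cumulantSum P (polyQ α) (doubleIntegral W P f)) := by
    intro f K a ha
    obtain ⟨J, b, lam, hb⟩ := exists_eigenbasis f.2
    rw [doubleIntegral_apply hW]
    exact hasSum_of_listsEigenvalues (φ := fun x => (polyQ α).eval x) (polyQ_eval_zero α) hb f.2
      (hasSum_cumulantSum hW hb (polyQ_coeff_zero α) (polyQ_coeff_one α)) ha
  have hnorm : ∀ f : symTensor2 H, cumulantSum P (polyQ α) (doubleIntegral W P f) =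
      ‖contrSum e (polyP α) (f : Tensor2 H)‖ ^ 2 := by
    intro f
    obtain ⟨J, b, lam, hb⟩ := exists_eigenbasis f.2
    rw [doubleIntegral_apply hW]
    -- Both quantities are the sum of `Q` over the same eigenbasis, so uniqueness of sums identifies
    -- them.
    exact (hasSum_cumulantSum hW hb (polyQ_coeff_zero α) (polyQ_coeff_one α)).unique
      (hasSum_norm_sq_contrSum e f.2 (polyP_coeff_zero α) b hb)
  have hgamma : ∀ f : symTensor2 H,
      1 / 2 * ∫ ω, gammaSum W P (polyP α) (doubleIntegral W P f) ω ^ 2 ∂P =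
        ‖contrSum e (polyP α) (f : Tensor2 H)‖ ^ 2 := by
    intro f
    rw [doubleIntegral_apply hW]
    exact integral_gammaSum_sq e hW f.2 (polyP α)
  have hroots : ∑ i, (polyQ α).eval (α i) = 0 :=
    Finset.sum_eq_zero fun i _ => polyQ_eval_root α i
  -- The list `α` carries all nonzero eigenvalues of the target kernel, and `Q` vanishes at each of
  -- them.
  have hzero : cumulantSum P (polyQ α) (doubleIntegral W P fInf) = 0 :=
    (hsum fInf hα).unique (hroots ▸ hasSum_fintype _)
  refine ⟨fun f => ⟨fun a ha => hsum f ha, hnorm f, (hnorm f).trans (hgamma f).symm,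
    fun r hr => ?_⟩, hzero, hroots, (hnorm fInf).symm.trans hzero,
    (hgamma fInf).trans ((hnorm fInf).symm.trans hzero)⟩
  obtain ⟨i, rfl⟩ : ∃ i, r = i + 1 := ⟨r - 1, by omega⟩
  refine ⟨iterContr_mem e f.2 _, ?_⟩
  rw [doubleIntegral_apply hW, doubleIntegral_apply hW]
  exact wickL_iterContr_ae_eq e hW f.2 i
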